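/- Let $1\le r\le M$ be integers, $m>0$ and $\gamma_T>0$ real. For each link $ab\in\{SD,RD\}$ let $h_{ab,1},\dots,h_{ab,M}$ be complex random channel coefficients whose amplitudes $(|h_{ab,1}|,\dots,|h_{ab,M}|)$ have the multivariate Nakagami-$m$ joint density, for $x_1,\dots,x_M\ge 0$ (and zero elsewhere), $$f_{ab}(x_1,\dots,x_M)=\int_0^\infty \frac{t^{m-1}e^{-t}}{\Gamma(m)}\prod_{l=1}^M \frac{2x_l^{2m-1}}{\Gamma(m)\left(\frac{\Omega_{ab,l}(1-\lambda_{ab,l}^2)}{m}\right)^m}\,e^{-\frac{m x_l^2}{\Omega_{ab,l}(1-\lambda_{ab,l}^2)}}\,e^{-\frac{\lambda_{ab,l}^2t}{1-\lambda_{ab,l}^2}}\;{}_0F_1\!\left(;m;\frac{m x_l^2\lambda_{ab,l}^2t}{\Omega_{ab,l}(1-\lambda_{ab,l}^2)^2}\right)dt,$$ with $\Omega_{ab,l}>0$ and $|\lambda_{ab,l}|<1$, and suppose that the random vectors $(h_{SD,l})_{l}$ and $(h_{RD,l})_{l}$ are independent. Let the signal-to-noise ratios be $\gamma_{SD,l}=P_{S,l}|h_{SD,l}|^2/\mathfrak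 N_{SD,l}$ and $\gamma_{RD,l}=P_{R,l}|h_{RD,l}|^2/\mathfrak N_{RD,l}$, where the positive transmission powers $P$ and noise variances $\mathfrak N$ satisfy $P_{S,l}/\mathfrak N_{SD,l}=P_{R,l}/\mathfrak N_{RD,l}=\gamma_T$ for all $l$, and put $$\bar\gamma_{M,r}=\sum_{l=1}^r\gamma_{SD,l}+\sum_{l=r+1}^M\gamma_{RD,l}.$$ Let $\rho_{ab}^{l,k}$ be the correlation coefficient of $|h_{ab,l}|^2$ and $|h_{ab,k}|^2$. Let $\mathbf F$ be the $M\times M$ diagonal matrix with diagonal entries $\Omega_{SD,1}/m,\dots,\Omega_{SD,r}/m,\Omega_{RD,r+1}/m,\dots,\Omega_{RD,M}/m$. Let $\mathbf E$ be the $M\times M$ matrix with entries $E_{ll}=1$; $E_{lk}=\sqrt{\rho_{SD}^{l,k}}$ for $l\ne k$, $l,k\le r$; $E_{lk}=\sqrt{\rho_{RD}^{l,k}}$ for $l\ne k$, $l,k>r$; and $E_{lk}=0$ otherwise. Put $\mathbf B=\mathbf F\mathbf E$. Then $\mathbf E$ is symmetric positive definite, the eigenvalues $\delta_1,\dots,\delta_M$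 of $\mathbf B$ (with algebraic multiplicity) are real and positive, and for every $y\ge 0$ the cumulative distribution function of $\bar\gamma_{M,r}$ is $$F_{\bar\gamma_{M,r}}(y)=\frac{y^{Mm}}{\gamma_T^{Mm}\,\det(\mathbf B)^m\,\Gamma(Mm+1)}\;\Phi_2^{(M)}\!\left(m,\dots,m;Mm+1;-\frac{y}{\gamma_T\delta_1},\dots,-\frac{y}{\gamma_T\delta_M}\right),$$ where $\Phi_2^{(M)}$ is the confluent Lauricella function $$\Phi_2^{(M)}(b_1,\dots,b_M;c;x_1,\dots,x_M)=\sum_{n_1,\dots,n_M\ge 0}\frac{(b_1)_{n_1}\cdots(b_M)_{n_M}}{(c)_{n_1+\cdots+n_M}}\,\frac{x_1^{n_1}\cdots x_M^{n_M}}{n_1!\cdots n_M!},$$ with $(b)_n=b(b+1)\cdots(b+n-1)$; the series converges absolutely at the arguments above. -/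

import Mathlib

open scoped Nat

noncomputable section

/-- The confluent hypergeometric limit function `₀F₁(; b; z) = ∑ₙ zⁿ / ((b)ₙ n!)`, with `(b)ₙ` the
rising factorial. -/
def hyp0F1 (b z : ℝ) : ℝ :=
  ∑' n : ℕ, z ^ n / ((ascPochhammer ℝ n).eval b * (n ! : ℝ))

/-- The term of index `n = (n₁, …, n_M)` of the confluent Lauricella series
`Φ₂^{(M)}(b₁, …, b_M; c; x₁, …, x_M)`. -/
def lauricellaPhi2Term {M : ℕ} (b : Fin M → ℝ) (c : ℝ) (x : Fin M → ℝ) (n : Fin M → ℕ) : ℝ :=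
  (∏ k, (ascPochhammer ℝ (n k)).eval (b k)) / (ascPochhammer ℝ (∑ k, n k)).eval c *
    ∏ k, x k ^ n k / ((n k)! : ℝ)

/-- The confluent Lauricella function `Φ₂^{(M)}(b₁, …, b_M; c; x₁, …, x_M)`. -/
def lauricellaPhi2 {M : ℕ} (b : Fin M → ℝ) (c : ℝ) (x : Fin M → ℝ) : ℝ :=
  ∑' n : Fin M → ℕ, lauricellaPhi2Term b c x n

/-- The joint density of multivariate Nakagami-`m` amplitudes with mean power gains `Om l` and
generalized correlation coefficients `lam l`; it vanishes outside the nonnegative orthant. -/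
def nakagamiJointPDF {M : ℕ} (m : ℝ) (Om lam : Fin M → ℝ) (x : Fin M → ℝ) : ℝ :=
  open Classical in
  if ∀ l, 0 ≤ x l then
    ∫ t in Set.Ioi (0 : ℝ), t ^ (m - 1) / Real.Gamma m * Real.exp (-t) *
      ∏ l, (2 * x l ^ (2 * m - 1) /
            (Real.Gamma m * (Om l * (1 - lam l ^ 2) / m) ^ m) *
          Real.exp (-(m * x l ^ 2 / (Om l * (1 - lam l ^ 2)))) *
          Real.exp (-(lam l ^ 2 * t / (1 - lam l ^ 2))) *
          hyp0F1 m (m * x l ^ 2 * lam l ^ 2 * t / (Om l * (1 - lam l ^ 2) ^ 2)))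
  else 0

/-- The vector of amplitudes `(|h₁|, …, |h_M|)` of the random channel coefficients `h` has the
multivariate Nakagami-`m` law. -/
def HasNakagamiAmplitudes {S : Type*} [MeasurableSpace S] (μ : MeasureTheory.Measure S) {M : ℕ}
    (m : ℝ) (Om lam : Fin M → ℝ) (h : Fin M → S → ℂ) : Prop :=
  μ.map (fun s l => ‖h l s‖) =
    (MeasureTheory.volume : MeasureTheory.Measure (Fin M → ℝ)).withDensity
      (fun x => ENNReal.ofReal (nakagamiJointPDF m Om lam x))

/-- The received signal-to-noise ratio `P |h|² / N`. -/
def snr {S : Type*} (P N : ℝ) (h : S → ℂ) (s : S) : ℝ := P * ‖h s‖ ^ 2 / N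

/-- The cross correlation coefficient of the squared amplitudes `|h_l|²` and `|h_k|²`. -/
def powerCorr {S : Type*} [MeasurableSpace S] (μ : MeasureTheory.Measure S) {M : ℕ}
    (h : Fin M → S → ℂ) (l k : Fin M) : ℝ :=
  ((∫ s, ‖h l s‖ ^ 2 * ‖h k s‖ ^ 2 ∂μ) - (∫ s, ‖h l s‖ ^ 2 ∂μ) * (∫ s, ‖h k s‖ ^ 2 ∂μ)) /
    √(ProbabilityTheory.variance (fun s => ‖h l s‖ ^ 2) μ *
      ProbabilityTheory.variance (fun s => ‖h k s‖ ^ 2) μ)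

/-- The sum of the first `r` source-destination SNRs and the last `M - r` relay-destination SNRs
(round `l + 1` has index `l`). -/
def sumSNR {S : Type*} {M : ℕ} (r : ℕ) (γSD γRD : Fin M → S → ℝ) (s : S) : ℝ :=
  ∑ l : Fin M, if (l : ℕ) < r then γSD l s else γRD l s

/-- The diagonal matrix `F`. -/
def gainMatrix {M : ℕ} (r : ℕ) (m : ℝ) (OmSD OmRD : Fin M → ℝ) : Matrix (Fin M) (Fin M) ℝ :=
  Matrix.diagonal fun l => if (l : ℕ) < r then OmSD l / m else OmRD l / m

/-- The block diagonal matrix `E`, with blocks of sizes `r` and `M - r`, with ones on the diagonal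
and square roots of cross correlation coefficients off the diagonal of each block. -/
def corrMatrix {M : ℕ} (r : ℕ) (ρSD ρRD : Fin M → Fin M → ℝ) : Matrix (Fin M) (Fin M) ℝ :=
  Matrix.of fun l k =>
    if l = k then 1
    else if (l : ℕ) < r ∧ (k : ℕ) < r then √(ρSD l k)
    else if r ≤ (l : ℕ) ∧ r ≤ (k : ℕ) then √(ρRD l k)
    else 0

/-- `δ₁, …, δ_M` are the eigenvalues of `B`, listed with algebraic multiplicity. -/
def IsEigenvalueList {M : ℕ} (B : Matrix (Fin M) (Fin M) ℝ) (δ : Fin M → ℝ) : Prop :=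
  B.charpoly = ∏ k, (Polynomial.X - Polynomial.C (δ k))

end

/-!
Write `X l = ‖h l‖ ^ 2` for one link, `θ l = Om l * (1 - lam l ^ 2) / m` and
`c l = lam l ^ 2 / (1 - lam l ^ 2)`. The joint density is a mixture of product densities over a
gamma variable `T` of shape `m`: given `T = t`, the `X l` are independent noncentral gamma variables,
that is, Poisson mixtures, with parameter `c l * t`, of gamma variables of shapes `m + n` and scale
`θ l` (`lintegral_condAmplitudePDF_mul`). Hence expectations of products of functions of the
amplitudes reduce to one-dimensional integrals (`HasNakagamiAmplitudes.lintegral_prod`). Two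
consequences are used.

* The moments of order at most two give the correlation coefficient `lam l ^ 2 * lam k ^ 2`
  (`HasNakagamiAmplitudes.powerCorr_eq`). So `E` is a positive diagonal matrix plus two rank one
  matrices with disjoint supports, one for each link; it is positive definite, and `F * E` is similar
  to the positive definite matrix `√F * E * √F`.
* The joint Laplace transform of the `X l` at `a` is the power `-m` of
  `∏ (1 + a l * θ l) * (1 + ∑ c l * (a l * θ l) / (1 + a l * θ l))`
  (`HasNakagamiAmplitudes.lintegral_exp`).

By independence of the links and the matrix determinant lemma, the Laplace transform of the summed
SNR at `s` is `det (1 + s * γT • B) ^ (-m) = ∏ (1 + s * γT * δ k) ^ (-m)`. On the other side, termwise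
integration of the Lauricella series for large `s` gives a product of binomial series
(`integral_exp_mul_lauricellaPhi2`), which shows that the claimed distribution function has the same
Laplace transform as the true one. Two such functions agree (`cdf_eq_of_laplace_eq`): in the variable
`u = exp (-y)` the Laplace transform at the natural numbers consists of integrals against powers of
`u`, and the Weierstrass approximation theorem applies.
-/

/-! ### Pochhammer symbols and multiple power series -/

theorem Real.Gamma_add_natCast {a : ℝ} (ha : 0 < a) (n : ℕ) :
    Real.Gamma (a + n) = (ascPochhammer ℝ n).eval a * Real.Gamma a := by
  induction n with
  | zero => simp
  | succ n ih =>
    have h : a + n ≠ 0 := by positivity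
    rw [Nat.cast_succ, ← add_assoc, Real.Gamma_add_one h, ih, ascPochhammer_succ_eval]
    ring

theorem ascPochhammer_eval_nonneg {a : ℝ} (ha : 0 ≤ a) (n : ℕ) :
    0 ≤ (ascPochhammer ℝ n).eval a := by
  induction n with
  | zero => simp
  | succ n ih => rw [ascPochhammer_succ_eval]; positivity

theorem ascPochhammer_eval_mul_le {a b : ℝ} (ha : 0 ≤ a) (hb : 0 ≤ b) (i j : ℕ) :
    (ascPochhammer ℝ i).eval a * (ascPochhammer ℝ j).eval b ≤
      (ascPochhammer ℝ (i + j)).eval (a + b) := by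
  induction j with
  | zero =>
    simp only [ascPochhammer_zero, Polynomial.eval_one, mul_one, add_zero]
    induction i with
    | zero => simp
    | succ i ih =>
      rw [ascPochhammer_succ_eval, ascPochhammer_succ_eval]
      have := ascPochhammer_eval_nonneg (add_nonneg ha hb) i
      gcongr
      linarith
  | succ j ih =>
    rw [ascPochhammer_succ_eval, ← add_assoc, ascPochhammer_succ_eval, ← mul_assoc]
    refine mul_le_mul ih ?_ (by positivity) (ascPochhammer_eval_nonneg (add_nonneg ha hb) _)
    push_cast
    linarith [(Nat.cast_nonneg i : (0 : ℝ) ≤ i)]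

theorem prod_ascPochhammer_eval_le {ι : Type*} (s : Finset ι) {b : ι → ℝ} (hb : ∀ i, 0 ≤ b i)
    (n : ι → ℕ) :
    ∏ i ∈ s, (ascPochhammer ℝ (n i)).eval (b i) ≤
      (ascPochhammer ℝ (∑ i ∈ s, n i)).eval (∑ i ∈ s, b i) := by
  classical
  induction s using Finset.induction_on with
  | empty => simp
  | insert i s hi ih =>
    rw [Finset.prod_insert hi, Finset.sum_insert hi, Finset.sum_insert hi]
    exact (mul_le_mul_of_nonneg_left ih (ascPochhammer_eval_nonneg (hb i) _)).trans
      (ascPochhammer_eval_mul_le (hb i) (Finset.sum_nonneg fun i _ => hb i) _ _)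

/-- The binomial series with a negative exponent. -/
theorem hasSum_ascPochhammer_mul_pow (a : ℝ) {z : ℝ} (hz : |z| < 1) :
    HasSum (fun n : ℕ => (ascPochhammer ℝ n).eval a * z ^ n / (n ! : ℝ)) ((1 - z) ^ (-a)) := by
  have h := (Real.one_div_one_sub_rpow_hasFPowerSeriesOnBall_zero a).hasSum (y := z)
    (by simpa [enorm_eq_nnnorm, ← NNReal.coe_lt_coe] using hz)
  have h1 : (0 : ℝ) ≤ 1 - z := by linarith [(abs_lt.mp hz).2]
  rw [zero_add, one_div, ← Real.rpow_neg h1] at h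
  suffices h2 : ∀ n : ℕ, (ascPochhammer ℝ n).eval a * z ^ n / (n ! : ℝ) =
      (FormalMultilinearSeries.ofScalars ℝ (fun n : ℕ => Ring.choose (a + n - 1) n) n)
        fun _ => z by
    simpa only [h2] using h
  intro n
  have h2 := Ring.factorial_nsmul_multichoose_eq_ascPochhammer a n
  rw [Polynomial.ascPochhammer_smeval_eq_eval, nsmul_eq_mul] at h2
  simp only [FormalMultilinearSeries.ofScalars_apply_eq, Ring.choose, smul_eq_mul]
  rw [← h2, show a + (n : ℝ) - 1 - n + 1 = a by ring]
  have : (n ! : ℝ) ≠ 0 := by positivity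
  field_simp

theorem summable_norm_ascPochhammer_mul_pow {a z : ℝ} (ha : 0 ≤ a) (hz : |z| < 1) :
    Summable fun n : ℕ => ‖(ascPochhammer ℝ n).eval a * z ^ n / (n ! : ℝ)‖ := by
  refine (hasSum_ascPochhammer_mul_pow a (z := |z|) (by simpa)).summable.congr fun n => ?_
  rw [norm_div, norm_mul, norm_pow, Real.norm_eq_abs, Real.norm_eq_abs, Real.norm_eq_abs,
    abs_of_nonneg (ascPochhammer_eval_nonneg ha n), Nat.abs_cast]

/-- A product of finitely many absolutely convergent series is the absolutely convergent multiple
series of the products of their terms. -/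
theorem summable_norm_and_tsum_prod_pi {M : ℕ} (f : Fin M → ℕ → ℝ)
    (hf : ∀ k, Summable fun n => ‖f k n‖) :
    (Summable fun n : Fin M → ℕ => ‖∏ k, f k (n k)‖) ∧
      ∑' n : Fin M → ℕ, ∏ k, f k (n k) = ∏ k, ∑' n, f k n := by
  induction M with
  | zero => exact ⟨Summable.of_finite, by simp⟩
  | succ M ih =>
    obtain ⟨h1, h2⟩ := ih (fun k => f k.succ) (fun k => hf k.succ)
    have key : (fun n : Fin (M + 1) → ℕ => ∏ k, f k (n k)) ∘ Fin.consEquiv (fun _ => ℕ) =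
        fun p => f 0 p.1 * ∏ k : Fin M, f k.succ (p.2 k) := by
      ext p
      simp [Fin.prod_univ_succ, Fin.consEquiv]
    constructor
    · rw [← (Fin.consEquiv (fun _ => ℕ)).summable_iff]
      have h3 := summable_mul_of_summable_norm (hf 0) h1
      convert h3.norm using 1
      ext p
      exact congrArg norm (congrFun key p)
    · rw [← (Fin.consEquiv (fun _ => ℕ)).tsum_eq, Fin.prod_univ_succ, ← h2,
        tsum_mul_tsum_of_summable_norm (hf 0) h1]
      exact tsum_congr fun p => congrFun key p

/-- The Pochhammer quotient in the Lauricella series is at most `1` when `∑ b ≤ c`, so that the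
series is dominated by a product of exponential series. -/
theorem norm_lauricellaPhi2Term_le {M : ℕ} {b : Fin M → ℝ} {c : ℝ} (hb : ∀ k, 0 ≤ b k)
    (hc : 0 < c) (hbc : ∑ k, b k ≤ c) (x : Fin M → ℝ) (n : Fin M → ℕ) :
    ‖lauricellaPhi2Term b c x n‖ ≤ ‖∏ k, x k ^ n k / ((n k)! : ℝ)‖ := by
  rw [lauricellaPhi2Term, norm_mul]
  refine mul_le_of_le_one_left (norm_nonneg _) ?_
  have h0 := ascPochhammer_pos (∑ k, n k) c hc
  have h1 : 0 ≤ ∏ k, (ascPochhammer ℝ (n k)).eval (b k) :=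
    Finset.prod_nonneg fun k _ => ascPochhammer_eval_nonneg (hb k) _
  rw [Real.norm_of_nonneg (div_nonneg h1 h0.le), div_le_one h0]
  refine (prod_ascPochhammer_eval_le _ hb n).trans ?_
  simpa using ascPochhammer_eval_mul_le (Finset.sum_nonneg fun k (_ : k ∈ Finset.univ) => hb k)
    (sub_nonneg.2 hbc) (∑ k, n k) 0

theorem summable_norm_prod_pow_div_factorial {M : ℕ} (x : Fin M → ℝ) :
    Summable fun n : Fin M → ℕ => ‖∏ k, x k ^ n k / ((n k)! : ℝ)‖ :=
  (summable_norm_and_tsum_prod_pi (fun k n => x k ^ n / (n ! : ℝ))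
    fun k => (Real.summable_pow_div_factorial (x k)).norm).1

theorem summable_lauricellaPhi2Term {M : ℕ} {b : Fin M → ℝ} {c : ℝ} (hb : ∀ k, 0 ≤ b k)
    (hc : 0 < c) (hbc : ∑ k, b k ≤ c) (x : Fin M → ℝ) :
    Summable (lauricellaPhi2Term b c x) :=
  (Summable.of_nonneg_of_le (fun _ => norm_nonneg _) (norm_lauricellaPhi2Term_le hb hc hbc x)
    (summable_norm_prod_pow_div_factorial x)).of_norm

theorem continuous_lauricellaPhi2 {M : ℕ} {b : Fin M → ℝ} {c : ℝ} (hb : ∀ k, 0 ≤ b k)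
    (hc : 0 < c) (hbc : ∑ k, b k ≤ c) : Continuous (lauricellaPhi2 b c) := by
  refine continuous_iff_continuousAt.2 fun x₀ => ?_
  refine ContinuousOn.continuousAt (s := Metric.ball 0 (‖x₀‖ + 1)) ?_
    (Metric.isOpen_ball.mem_nhds (by simp))
  refine continuousOn_tsum (fun n => ?_)
    (summable_norm_prod_pow_div_factorial fun _ => ‖x₀‖ + 1) fun n x hx =>
      (norm_lauricellaPhi2Term_le hb hc hbc x n).trans ?_
  · unfold lauricellaPhi2Term
    fun_prop
  · rw [norm_prod, norm_prod]
    refine Finset.prod_le_prod (fun _ _ => norm_nonneg _) fun k _ => ?_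
    rw [norm_div, norm_div, norm_pow, norm_pow]
    have h : ‖x k‖ ≤ ‖x₀‖ + 1 := (norm_le_pi_norm x k).trans (mem_ball_zero_iff.1 hx).le
    have h2 : ‖‖x₀‖ + 1‖ = ‖x₀‖ + 1 := Real.norm_of_nonneg (by positivity)
    rw [h2]
    gcongr

/-! ### Laplace transforms -/

open MeasureTheory Set Filter Topology in
/-- An integrable function on `(0, ∞)` whose Laplace transform vanishes at the natural numbers is
almost everywhere zero: with `u = exp (-y)` these values are integrals against the powers of `u`,
and polynomials in `u` are uniformly dense by the Weierstrass theorem. -/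
theorem ae_eq_zero_of_forall_integral_exp_eq_zero {h : ℝ → ℝ} (hh : IntegrableOn h (Ioi 0))
    (h0 : ∀ n : ℕ, ∫ y in Ioi (0 : ℝ), Real.exp (-y) ^ n * h y = 0) :
    ∀ᵐ y, y ∈ Ioi (0 : ℝ) → h y = 0 := by
  refine isOpen_Ioi.ae_eq_zero_of_integral_contDiff_smul_eq_zero hh.locallyIntegrableOn ?_
  intro g hg hgc hgs
  have hg0 : ∀ y, y ∉ Ioi (0 : ℝ) → g y = 0 := fun y hy =>
    image_eq_zero_of_notMem_tsupport fun hy' => hy (hgs hy')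
  rw [← setIntegral_eq_integral_of_forall_compl_eq_zero (s := Ioi 0)
    (fun y hy => by rw [hg0 y hy, zero_smul])]
  -- The function `g` in the variable `u = exp (-y)`. At `u = 0` the junk value `log 0 = 0` gives the
  -- right limit, because `g` vanishes both at `0` and near infinity.
  have hψ : Continuous fun u => g (-Real.log u) := by
    refine continuous_iff_continuousAt.2 fun u => ?_
    rcases eq_or_ne u 0 with rfl | hu
    · refine continuousAt_iff_punctured_nhds.2 ?_
      rw [Real.log_zero, neg_zero, hg0 0 (by simp)]
      have h1 : Tendsto g atTop (𝓝 0) :=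
        hgc.is_zero_at_infty.mono_left atTop_le_cocompact
      exact h1.comp (tendsto_neg_atBot_atTop.comp Real.tendsto_log_nhdsNE_zero)
    · exact hg.continuous.continuousAt.comp (Real.continuousAt_log hu).neg
  have hexp : ∀ y ∈ Ioi (0 : ℝ), Real.exp (-y) ∈ Icc (0 : ℝ) 1 := fun y hy =>
    ⟨(Real.exp_pos _).le, Real.exp_le_one_iff.2 (by simpa using (mem_Ioi.1 hy).le)⟩
  have hpow : ∀ n : ℕ, IntegrableOn (fun y => Real.exp (-y) ^ n * h y) (Ioi 0) := fun n => by
    refine Integrable.mono hh ((by fun_prop : Continuous fun y : ℝ =>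
      Real.exp (-y) ^ n).aestronglyMeasurable.mul hh.1) ?_
    filter_upwards [ae_restrict_mem measurableSet_Ioi] with y hy
    rw [norm_mul, norm_pow, Real.norm_of_nonneg (hexp y hy).1]
    exact mul_le_of_le_one_left (norm_nonneg _) (pow_le_one₀ (hexp y hy).1 (hexp y hy).2)
  have hgh : IntegrableOn (fun y => g y • h y) (Ioi 0) := by
    obtain ⟨C, hC⟩ := hgc.exists_bound_of_continuous hg.continuous
    exact Integrable.bdd_mul hh hg.continuous.aestronglyMeasurable (Eventually.of_forall hC)
  have key : ∀ ε > 0, |∫ y in Ioi (0 : ℝ), g y • h y| ≤ ε * ∫ y in Ioi (0 : ℝ), |h y| := by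
    intro ε hε
    obtain ⟨p, hp⟩ := exists_polynomial_near_of_continuousOn 0 1 _ hψ.continuousOn ε hε
    have hpi : IntegrableOn (fun y => p.eval (Real.exp (-y)) * h y) (Ioi 0) ∧
        ∫ y in Ioi (0 : ℝ), p.eval (Real.exp (-y)) * h y = 0 := by
      simp only [Polynomial.eval_eq_sum_range, Finset.sum_mul, mul_assoc]
      refine ⟨integrable_finsetSum _ fun n _ => (hpow n).const_mul _, ?_⟩
      rw [integral_finsetSum _ fun n _ => (hpow n).const_mul _]
      refine Finset.sum_eq_zero fun n _ => ?_
      rw [integral_const_mul, h0, mul_zero]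
    have hsub : ∫ y in Ioi (0 : ℝ), g y • h y =
        ∫ y in Ioi (0 : ℝ), (g y • h y - p.eval (Real.exp (-y)) * h y) := by
      rw [integral_sub hgh hpi.1, hpi.2, sub_zero]
    rw [hsub, ← integral_const_mul]
    refine (norm_integral_le_integral_norm _).trans
      (setIntegral_mono_on (hgh.sub hpi.1).norm (hh.norm.const_mul ε) measurableSet_Ioi ?_)
    intro y hy
    have h1 := hp _ (hexp y hy)
    rw [Real.log_exp, neg_neg, abs_sub_comm] at h1
    simp only [Pi.sub_apply, smul_eq_mul]
    rw [← sub_mul, norm_mul]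
    exact mul_le_mul_of_nonneg_right h1.le (norm_nonneg _)
  have hlim : Tendsto (fun ε : ℝ => ε * ∫ y in Ioi (0 : ℝ), |h y|) (𝓝[>] 0) (𝓝 0) := by
    have : Continuous fun ε : ℝ => ε * ∫ y in Ioi (0 : ℝ), |h y| := by fun_prop
    simpa using (this.tendsto 0).mono_left nhdsWithin_le_nhds
  exact abs_nonpos_iff.1 (ge_of_tendsto hlim (eventually_mem_nhdsWithin.mono key))

open MeasureTheory Set in
/-- Fubini's theorem computes the Laplace transform of a distribution function from that of the
distribution. -/
theorem lintegral_exp_mul_measure_Iic (ν : Measure ℝ) [SFinite ν] (hν : ∀ᵐ x ∂ν, 0 ≤ x)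
    {s : ℝ} (hs : 0 < s) :
    ∫⁻ y in Ioi (0 : ℝ), ENNReal.ofReal (Real.exp (-(s * y))) * ν (Iic y) =
      ENNReal.ofReal (1 / s) * ∫⁻ x, ENNReal.ofReal (Real.exp (-(s * x))) ∂ν := by
  have h1 : ∀ y, ENNReal.ofReal (Real.exp (-(s * y))) * ν (Iic y) =
      ∫⁻ x, {q : ℝ × ℝ | q.2 ≤ q.1}.indicator
        (fun q => ENNReal.ofReal (Real.exp (-(s * q.1)))) (y, x) ∂ν := fun y => by
    rw [← setLIntegral_const, ← lintegral_indicator measurableSet_Iic]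
    rfl
  have hm : Measurable ({q : ℝ × ℝ | q.2 ≤ q.1}.indicator
      fun q => ENNReal.ofReal (Real.exp (-(s * q.1)))) :=
    Measurable.indicator (by fun_prop) (measurableSet_le measurable_snd measurable_fst)
  simp_rw [h1]
  rw [lintegral_lintegral_swap (by exact hm.aemeasurable),
    ← lintegral_const_mul _ (by fun_prop)]
  refine lintegral_congr_ae ?_
  filter_upwards [hν] with x hx
  have h2 : ∀ y, {q : ℝ × ℝ | q.2 ≤ q.1}.indicator
      (fun q => ENNReal.ofReal (Real.exp (-(s * q.1)))) (y, x) =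
      (Ici x).indicator (fun y => ENNReal.ofReal (Real.exp (-(s * y)))) y := fun y => rfl
  simp_rw [h2]
  rw [lintegral_indicator measurableSet_Ici, Measure.restrict_restrict measurableSet_Ici,
    setLIntegral_congr (t := Ioi x), ← ofReal_integral_eq_lintegral_ofReal]
  · have h3 := integral_exp_mul_Ioi (a := -s) (by linarith) x
    simp only [neg_mul] at h3
    rw [h3, ← ENNReal.ofReal_mul (by positivity)]
    congr 1
    field_simp
  · have h3 := integrableOn_exp_mul_Ioi (a := -s) (by linarith) x
    simp only [neg_mul] at h3
    exact h3
  · exact Filter.Eventually.of_forall fun y => (Real.exp_pos _).le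
  · refine (ae_eq_set_inter Ioi_ae_eq_Ici.symm (ae_eq_refl (Ioi (0:ℝ)))).trans ?_
    rw [inter_eq_left.2 (Ioi_subset_Ioi hx)]
    rfl

open MeasureTheory Set Filter Topology ProbabilityTheory in
/-- A continuous function on `[0, ∞)` which has, far enough to the right, the same Laplace transform
as the distribution function of a probability measure on `[0, ∞)` is equal to it. -/
theorem cdf_eq_of_laplace_eq (ν : Measure ℝ) [IsProbabilityMeasure ν] (hν : ∀ᵐ x ∂ν, 0 ≤ x)
    {G L : ℝ → ℝ} (hG : ContinuousOn G (Ici 0)) {s₀ : ℝ} (hs₀ : 0 < s₀)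
    (hL : ∀ s, s₀ ≤ s → 0 < L s)
    (hνL : ∀ s, s₀ ≤ s → ∫⁻ x, ENNReal.ofReal (Real.exp (-(s * x))) ∂ν = ENNReal.ofReal (L s))
    (hGL : ∀ s, s₀ ≤ s → ∫ y in Ioi (0 : ℝ), Real.exp (-(s * y)) * G y = 1 / s * L s)
    {y : ℝ} (hy : 0 ≤ y) : cdf ν y = G y := by
  have hs : ∀ n : ℕ, s₀ ≤ s₀ + n := fun n => by linarith [(Nat.cast_nonneg n : (0 : ℝ) ≤ n)]
  have hint : ∀ s, s₀ ≤ s → IntegrableOn (fun y => Real.exp (-(s * y)) * G y) (Ioi 0) :=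
    fun s h => Integrable.of_integral_ne_zero (by
      rw [hGL s h]
      have := hL s h
      have : 0 < s := hs₀.trans_le h
      positivity)
  have hF : ∀ s, s₀ ≤ s → ∫ y in Ioi (0 : ℝ), Real.exp (-(s * y)) * cdf ν y = 1 / s * L s := by
    intro s h
    have h1 : 0 < s := hs₀.trans_le h
    rw [integral_eq_lintegral_of_nonneg_ae
      (Eventually.of_forall fun y => mul_nonneg (Real.exp_pos _).le (cdf_nonneg _ _))
      ((by fun_prop : Continuous fun y : ℝ => Real.exp (-(s * y))).aestronglyMeasurable.mul
        (monotone_cdf ν).measurable.aestronglyMeasurable)]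
    simp_rw [ENNReal.ofReal_mul (Real.exp_pos _).le, ofReal_cdf]
    rw [lintegral_exp_mul_measure_Iic ν hν h1, hνL s h, ← ENNReal.ofReal_mul (by positivity),
      ENNReal.toReal_ofReal (mul_nonneg (by positivity) (hL s h).le)]
  have hFint : ∀ s, s₀ ≤ s → IntegrableOn (fun y => Real.exp (-(s * y)) * cdf ν y) (Ioi 0) :=
    fun s h => Integrable.of_integral_ne_zero (by
      rw [hF s h]
      have := hL s h
      have : 0 < s := hs₀.trans_le h
      positivity)
  have key := ae_eq_zero_of_forall_integral_exp_eq_zero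
    (h := fun y => Real.exp (-(s₀ * y)) * cdf ν y - Real.exp (-(s₀ * y)) * G y)
    ((hFint s₀ le_rfl).sub (hint s₀ le_rfl)) (fun n => by
      have h1 : ∀ y : ℝ, Real.exp (-y) ^ n *
          (Real.exp (-(s₀ * y)) * cdf ν y - Real.exp (-(s₀ * y)) * G y) =
          Real.exp (-((s₀ + n) * y)) * cdf ν y - Real.exp (-((s₀ + n) * y)) * G y := fun y => by
        rw [show -((s₀ + n) * y) = n * (-y) + -(s₀ * y) by ring, Real.exp_add, Real.exp_nat_mul]
        ring
      simp_rw [h1]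
      rw [integral_sub (hFint _ (hs n)) (hint _ (hs n)), hF _ (hs n), hGL _ (hs n), sub_self])
  have h1 : ∀ᵐ z, z ∈ Ioi y → cdf ν z = G z := by
    filter_upwards [key] with z hz hz'
    have h2 := hz (lt_of_le_of_lt hy hz')
    rw [← mul_sub] at h2
    exact sub_eq_zero.1 ((mul_eq_zero.1 h2).resolve_left (Real.exp_pos _).ne')
  -- Both functions are right continuous, so agreement almost everywhere to the right of `y` suffices.
  have h2 : ∃ᶠ z in 𝓝[>] y, cdf ν z = G z := by
    rw [frequently_iff]
    intro U hU
    obtain ⟨b, hb, hbU⟩ := mem_nhdsGT_iff_exists_Ioo_subset.1 hU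
    by_contra hcon
    have h3 : Ioo y b ⊆ {z | ¬ (z ∈ Ioi y → cdf ν z = G z)} := fun z hz h4 =>
      hcon ⟨z, hbU hz, h4 hz.1⟩
    have h4 := measure_mono_null h3 (ae_iff.1 h1)
    rw [Real.volume_Ioo, ENNReal.ofReal_eq_zero] at h4
    exact absurd (mem_Ioi.1 hb) (by linarith)
  have hFy : Tendsto (cdf ν) (𝓝[>] y) (𝓝 (cdf ν y)) :=
    ((cdf ν).right_continuous y).tendsto.mono_left (nhdsWithin_mono _ Ioi_subset_Ici_self)
  have hGy : Tendsto G (𝓝[>] y) (𝓝 (G y)) :=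
    (hG y hy).tendsto.mono_left
      (nhdsWithin_mono _ (Ioi_subset_Ici_self.trans (Ici_subset_Ici.2 hy)))
  exact tendsto_nhds_unique_of_frequently_eq hFy hGy h2

open MeasureTheory Set in
/-- Termwise integration of the Lauricella series: the resulting multiple series is a product of
binomial series. -/
theorem integral_exp_mul_lauricellaPhi2 {M : ℕ} {b β : Fin M → ℝ} {A s : ℝ} (hA : 0 < A)
    (hb : ∀ k, 0 ≤ b k) (hβ : ∀ k, 0 ≤ β k) (hs : 0 < s) (hβs : ∀ k, β k < s) :
    ∫ y in Ioi (0 : ℝ), Real.exp (-(s * y)) *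
        (y ^ A / Real.Gamma (A + 1) * lauricellaPhi2 b (A + 1) (fun k => -(y * β k))) =
      1 / s * ((1 / s) ^ A * ∏ k, (1 + β k / s) ^ (-b k)) := by
  set C : (Fin M → ℕ) → ℝ := fun n =>
    ∏ k, ((ascPochhammer ℝ (n k)).eval (b k) * (-β k / s) ^ n k / ((n k)! : ℝ)) with hC
  have hz : ∀ k, |(-β k / s)| < 1 := fun k => by
    rw [abs_div, abs_neg, abs_of_nonneg (hβ k), abs_of_pos hs, div_lt_one hs]
    exact hβs k
  obtain ⟨hCs, hCt⟩ := summable_norm_and_tsum_prod_pi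
    (fun k n => (ascPochhammer ℝ n).eval (b k) * (-β k / s) ^ n / (n ! : ℝ))
    (fun k => summable_norm_ascPochhammer_mul_pow (hb k) (hz k))
  -- Each term is a multiple of `y ^ (N n - 1) * exp (-(s * y))`; its integral cancels the Pochhammer
  -- symbol in the denominator, which is a quotient of Gamma values.
  set F : (Fin M → ℕ) → ℝ → ℝ := fun n y => Real.exp (-(s * y)) *
    (y ^ A / Real.Gamma (A + 1) * lauricellaPhi2Term b (A + 1) (fun k => -(y * β k)) n) with hFd
  set N : (Fin M → ℕ) → ℝ := fun n => A + 1 + (∑ k, n k : ℕ) with hN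
  have hNpos : ∀ n, 0 < N n := fun n => by positivity
  have hF : ∀ n, ∀ y ∈ Ioi (0 : ℝ), F n y =
      (C n * s ^ (∑ k, n k) / Real.Gamma (N n)) * (y ^ (N n - 1) * Real.exp (-(s * y))) := by
    intro n y hy
    have hy' : (0 : ℝ) < y := hy
    have h1 : N n - 1 = A + (∑ k, n k : ℕ) := by rw [hN]; ring
    have h2 : C n * s ^ (∑ k, n k) * y ^ (∑ k, n k) =
        (∏ k, (ascPochhammer ℝ (n k)).eval (b k)) *
          ∏ k, (-(y * β k)) ^ n k / ((n k)! : ℝ) := by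
      rw [hC, ← Finset.prod_pow_eq_pow_sum, ← Finset.prod_pow_eq_pow_sum, ← Finset.prod_mul_distrib,
        ← Finset.prod_mul_distrib, ← Finset.prod_mul_distrib]
      refine Finset.prod_congr rfl fun k _ => ?_
      rw [show -(y * β k) = (-β k / s) * s * y by field_simp, mul_pow, mul_pow]
      ring
    have h3 := Real.Gamma_pos_of_pos (by positivity : 0 < A + 1)
    have h4 := ascPochhammer_pos (∑ k, n k) (A + 1) (by positivity)
    rw [h1, Real.rpow_add_natCast hy'.ne', hFd]
    simp only [lauricellaPhi2Term, hN]
    rw [Real.Gamma_add_natCast (by positivity : 0 < A + 1)]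
    have h5 : (∏ k, (ascPochhammer ℝ (n k)).eval (b k)) / (ascPochhammer ℝ (∑ k, n k)).eval (A + 1) *
        ∏ k, (-(y * β k)) ^ n k / ((n k)! : ℝ) =
        C n * s ^ (∑ k, n k) * y ^ (∑ k, n k) / (ascPochhammer ℝ (∑ k, n k)).eval (A + 1) := by
      rw [h2]; ring
    rw [h5]
    field_simp
  have hI : ∀ n, ∫ y in Ioi (0 : ℝ), y ^ (N n - 1) * Real.exp (-(s * y)) =
      (1 / s) ^ (N n) * Real.Gamma (N n) := fun n =>
    Real.integral_rpow_mul_exp_neg_mul_Ioi (hNpos n) hs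
  have hIint : ∀ n, IntegrableOn (fun y => y ^ (N n - 1) * Real.exp (-(s * y))) (Ioi 0) :=
    fun n => Integrable.of_integral_ne_zero (by
      rw [hI n]
      have := Real.Gamma_pos_of_pos (hNpos n)
      positivity)
  have hval : ∀ n (c : ℝ), c * s ^ (∑ k, n k) / Real.Gamma (N n) *
      ((1 / s) ^ (N n) * Real.Gamma (N n)) = (1 / s) ^ (A + 1) * c := fun n c => by
    have := (Real.Gamma_pos_of_pos (hNpos n)).ne'
    rw [hN] at this ⊢
    rw [Real.rpow_add_natCast (by positivity), one_div_pow]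
    field_simp
  have h := hasSum_integral_of_summable_integral_norm (μ := volume.restrict (Ioi (0 : ℝ)))
    (F := F) (fun n => by
      refine IntegrableOn.congr_fun ((hIint n).const_mul _) (fun y hy => (hF n y hy).symm)
        measurableSet_Ioi) (by
      refine (hCs.mul_left ((1 / s) ^ (A + 1))).congr fun n => ?_
      rw [setIntegral_congr_fun measurableSet_Ioi
        (g := fun y => (‖C n‖ * s ^ (∑ k, n k) / Real.Gamma (N n)) *
          (y ^ (N n - 1) * Real.exp (-(s * y)))) fun y hy => ?_,
        integral_const_mul, hI, hval]
      have hy' : (0 : ℝ) < y := hy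
      have := Real.Gamma_pos_of_pos (hNpos n)
      simp only []
      rw [hF n y hy, norm_mul, norm_div, norm_mul, Real.norm_of_nonneg this.le,
        Real.norm_of_nonneg (by positivity : 0 ≤ s ^ (∑ k, n k)),
        Real.norm_of_nonneg (by positivity : 0 ≤ y ^ (N n - 1) * Real.exp (-(s * y)))])
  have h2 : ∀ n, ∫ y in Ioi (0 : ℝ), F n y = (1 / s) ^ (A + 1) * C n := fun n => by
    rw [setIntegral_congr_fun measurableSet_Ioi (hF n), integral_const_mul, hI, hval]
  have h3 := h.tsum_eq
  simp_rw [h2, tsum_mul_left] at h3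
  have h4 : ∀ y, ∑' n, F n y = Real.exp (-(s * y)) *
      (y ^ A / Real.Gamma (A + 1) * lauricellaPhi2 b (A + 1) (fun k => -(y * β k))) := fun y => by
    simp only [hFd, lauricellaPhi2, tsum_mul_left]
  simp_rw [h4] at h3
  rw [← h3, hC, hCt, Real.rpow_add_one (by positivity)]
  have h5 : ∀ k, ∑' n : ℕ, (ascPochhammer ℝ n).eval (b k) * (-β k / s) ^ n / (n ! : ℝ) =
      (1 + β k / s) ^ (-b k) := fun k => by
    rw [(hasSum_ascPochhammer_mul_pow (b k) (hz k)).tsum_eq, neg_div, sub_neg_eq_add]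
  simp_rw [h5]
  ring

/-! ### Amplitudes conditioned on the mixing variable -/

theorem hasSum_of_eq {f g : ℕ → ℝ} {a b : ℝ} (h : HasSum f a) (hfg : ∀ n, f n = g n)
    (hab : a = b) : HasSum g b := by
  rwa [← funext hfg, ← hab]

theorem summable_hyp0F1 {b : ℝ} (hb : 0 < b) (z : ℝ) :
    Summable fun n : ℕ => z ^ n / ((ascPochhammer ℝ n).eval b * (n ! : ℝ)) := by
  refine Summable.of_norm_bounded_eventually_nat
    (g := fun n => b⁻¹ * ‖z ^ n / (n ! : ℝ)‖)
    ((Real.summable_pow_div_factorial z).norm.mul_left _) ?_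
  filter_upwards [Filter.eventually_ge_atTop 1] with n hn
  obtain ⟨n, rfl⟩ := Nat.exists_eq_add_of_le' hn
  have h1 : b ≤ (ascPochhammer ℝ (n + 1)).eval b := by
    induction n with
    | zero => simp
    | succ n ih =>
      rw [ascPochhammer_succ_eval]
      have h2 := ih (by omega)
      push_cast
      nlinarith [(Nat.cast_nonneg n : (0 : ℝ) ≤ n)]
  have h3 : 0 < (ascPochhammer ℝ (n + 1)).eval b := hb.trans_le h1
  rw [norm_div, norm_mul, Real.norm_of_nonneg h3.le, norm_div, div_mul_eq_div_div, div_right_comm,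
    div_eq_inv_mul]
  gcongr

theorem hyp0F1_nonneg {b z : ℝ} (hb : 0 < b) (hz : 0 ≤ z) : 0 ≤ hyp0F1 b z :=
  tsum_nonneg fun n => by have := ascPochhammer_pos n b hb; positivity

theorem measurable_hyp0F1 {b : ℝ} (hb : 0 < b) : Measurable (hyp0F1 b) := by
  refine measurable_of_tendsto_metrizable (f := fun (N : ℕ) z =>
    ∑ n ∈ Finset.range N, z ^ n / ((ascPochhammer ℝ n).eval b * (n ! : ℝ)))
    (fun N => by fun_prop) ?_
  exact tendsto_pi_nhds.2 fun z => (summable_hyp0F1 hb z).hasSum.tendsto_sum_nat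

/-- The density of a single Nakagami amplitude given the value `t` of the gamma distributed mixing
variable, that is, of the square root of a noncentral gamma variable. -/
noncomputable def condAmplitudePDF (m Om lam t x : ℝ) : ℝ :=
  2 * x ^ (2 * m - 1) / (Real.Gamma m * (Om * (1 - lam ^ 2) / m) ^ m) *
    Real.exp (-(m * x ^ 2 / (Om * (1 - lam ^ 2)))) *
    Real.exp (-(lam ^ 2 * t / (1 - lam ^ 2))) *
    hyp0F1 m (m * x ^ 2 * lam ^ 2 * t / (Om * (1 - lam ^ 2) ^ 2))

/-- The density of the mixing variable, the gamma density of shape `m` and rate `1`. -/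
noncomputable def mixingPDF (m t : ℝ) : ℝ := t ^ (m - 1) / Real.Gamma m * Real.exp (-t)

theorem one_sub_sq_pos {lam : ℝ} (hlam : |lam| < 1) : 0 < 1 - lam ^ 2 :=
  sub_pos.2 ((sq_lt_one_iff_abs_lt_one _).2 hlam)

theorem condAmplitudePDF_nonneg {m Om lam t x : ℝ} (hm : 0 < m) (hOm : 0 < Om) (hlam : |lam| < 1)
    (ht : 0 ≤ t) (hx : 0 ≤ x) : 0 ≤ condAmplitudePDF m Om lam t x := by
  have h1 := one_sub_sq_pos hlam
  have h2 := Real.Gamma_pos_of_pos hm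
  have h3 := hyp0F1_nonneg hm
    (by positivity : 0 ≤ m * x ^ 2 * lam ^ 2 * t / (Om * (1 - lam ^ 2) ^ 2))
  rw [condAmplitudePDF]
  positivity

theorem mixingPDF_nonneg {m t : ℝ} (hm : 0 < m) (ht : 0 ≤ t) : 0 ≤ mixingPDF m t := by
  have h2 := Real.Gamma_pos_of_pos hm
  rw [mixingPDF]
  positivity

theorem measurable_condAmplitudePDF {m : ℝ} (hm : 0 < m) (Om lam : ℝ) :
    Measurable fun q : ℝ × ℝ => condAmplitudePDF m Om lam q.1 q.2 := by
  unfold condAmplitudePDF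
  refine Measurable.mul (by fun_prop) ((measurable_hyp0F1 hm).comp (by fun_prop))

theorem measurable_mixingPDF (m : ℝ) : Measurable (mixingPDF m) := by
  unfold mixingPDF
  fun_prop

open MeasureTheory Set in
/-- Termwise integration of the series of `₀F₁`: given the mixing variable, the squared amplitude is
a Poisson mixture of gamma variables of shapes `m + n`. -/
theorem lintegral_condAmplitudePDF_mul {m Om lam t s : ℝ} (hm : 0 < m) (hOm : 0 < Om)
    (hlam : |lam| < 1) (ht : 0 ≤ t) (hs : 0 ≤ s) (j : ℕ) {θ p S : ℝ}
    (hθ : θ = Om * (1 - lam ^ 2) / m) (hp : p = lam ^ 2 / (1 - lam ^ 2) * t)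
    (hS : HasSum (fun n : ℕ => p ^ n / (n ! : ℝ) * (ascPochhammer ℝ j).eval (m + n) *
      (1 + s * θ)⁻¹ ^ n) S) :
    ∫⁻ x in Ici (0 : ℝ), ENNReal.ofReal (condAmplitudePDF m Om lam t x) *
        ENNReal.ofReal ((x ^ 2) ^ j * Real.exp (-(s * x ^ 2))) =
      ENNReal.ofReal (Real.exp (-p) * θ ^ j * (1 + s * θ) ^ (-(m + j)) * S) := by
  have h1 := one_sub_sq_pos hlam
  have hθ0 : 0 < θ := by rw [hθ]; positivity
  have hp0 : 0 ≤ p := by rw [hp]; positivity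
  have hσ : 0 < 1 + s * θ := by positivity
  have hΓ : ∀ n : ℕ, 0 < Real.Gamma (m + n) := fun n => Real.Gamma_pos_of_pos (by positivity)
  have hΓm := Real.Gamma_pos_of_pos hm
  set q : ℕ → ℝ := fun n => 2 * (m + n + j : ℝ) - 1 with hq
  set c : ℕ → ℝ := fun n => Real.exp (-p) * (p ^ n / (n ! : ℝ)) *
    (2 / (Real.Gamma (m + n) * θ ^ (m + n))) with hc
  have hc0 : ∀ n, 0 ≤ c n := fun n => by
    have := hΓ n
    rw [hc]; positivity
  -- Restriction to `x > 0` lets the exponents be added, and changes the integral by a null set.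
  have hterm : ∀ x ∈ Ioi (0 : ℝ), HasSum
      (fun n => c n * (x ^ q n * Real.exp (-(1 / θ + s) * x ^ (2 : ℝ))))
      (condAmplitudePDF m Om lam t x * ((x ^ 2) ^ j * Real.exp (-(s * x ^ 2)))) := by
    intro x hx
    have hx0 : (0 : ℝ) < x := hx
    have hz : m * x ^ 2 * lam ^ 2 * t / (Om * (1 - lam ^ 2) ^ 2) = x ^ 2 * p / θ := by
      rw [hp, hθ]; field_simp
    have hz2 : m * x ^ 2 / (Om * (1 - lam ^ 2)) = x ^ 2 / θ := by
      rw [hθ]; field_simp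
    have hz3 : lam ^ 2 * t / (1 - lam ^ 2) = p := by
      rw [hp]; field_simp
    have h := ((summable_hyp0F1 hm (x ^ 2 * p / θ)).hasSum.mul_left
      (2 * x ^ (2 * m - 1) / (Real.Gamma m * θ ^ m) * Real.exp (-(x ^ 2 / θ)) *
        Real.exp (-p))).mul_right ((x ^ 2) ^ j * Real.exp (-(s * x ^ 2)))
    rw [condAmplitudePDF, hz, hz2, hz3, ← hθ]
    suffices h2 : ∀ n : ℕ, c n * (x ^ q n * Real.exp (-(1 / θ + s) * x ^ (2 : ℝ))) =
        2 * x ^ (2 * m - 1) / (Real.Gamma m * θ ^ m) * Real.exp (-(x ^ 2 / θ)) * Real.exp (-p) *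
          ((x ^ 2 * p / θ) ^ n / ((ascPochhammer ℝ n).eval m * (n ! : ℝ))) *
          ((x ^ 2) ^ j * Real.exp (-(s * x ^ 2))) by
      exact hasSum_of_eq h (fun n => (h2 n).symm) rfl
    intro n
    have h3 : x ^ q n = x ^ (2 * m - 1) * (x ^ 2) ^ n * (x ^ 2) ^ j := by
      rw [show q n = (2 * m - 1) + (2 * n + 2 * j : ℕ) by rw [hq]; push_cast; ring,
        Real.rpow_add_natCast hx0.ne', pow_add, pow_mul, pow_mul, mul_assoc]
    have h4 : Real.exp (-(1 / θ + s) * x ^ (2 : ℝ)) =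
        Real.exp (-(x ^ 2 / θ)) * Real.exp (-(s * x ^ 2)) := by
      rw [← Real.exp_add, Real.rpow_two]
      congr 1
      ring
    have h5 := ascPochhammer_pos n m hm
    rw [h3, h4, hc]
    simp only [Real.Gamma_add_natCast hm, Real.rpow_add_natCast hθ0.ne', div_pow, mul_pow]
    field_simp
  have hint : ∀ n, ∫ x in Ioi (0 : ℝ), x ^ q n * Real.exp (-(1 / θ + s) * x ^ (2 : ℝ)) =
      (1 / θ + s) ^ (-(m + n + j)) * (1 / 2) * Real.Gamma (m + n + j) := fun n => by
    rw [integral_rpow_mul_exp_neg_mul_rpow (by norm_num) (by rw [hq]; linarith [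
      (by positivity : (0 : ℝ) < m + n + j)]) (by positivity)]
    congr 3 <;> · rw [hq]; ring
  have hval : ∀ n : ℕ, c n * ((1 / θ + s) ^ (-(m + n + j)) * (1 / 2) * Real.Gamma (m + n + j)) =
      Real.exp (-p) * θ ^ j * (1 + s * θ) ^ (-(m + j)) *
        (p ^ n / (n ! : ℝ) * (ascPochhammer ℝ j).eval (m + n) * (1 + s * θ)⁻¹ ^ n) := by
    intro n
    have h2 : (1 / θ + s) ^ (-(m + n + j)) =
        θ ^ (m + n) * θ ^ j * ((1 + s * θ) ^ (-(m + j)) * (1 + s * θ)⁻¹ ^ n) := by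
      rw [show 1 / θ + s = θ⁻¹ * (1 + s * θ) by field_simp,
        Real.mul_rpow (by positivity) hσ.le, Real.inv_rpow hθ0.le, ← Real.rpow_neg hθ0.le, neg_neg,
        Real.rpow_add_natCast hθ0.ne', ← Real.rpow_natCast (1 + s * θ)⁻¹, Real.inv_rpow hσ.le,
        ← Real.rpow_neg hσ.le, ← Real.rpow_add hσ]
      congr 2
      ring
    have h3 := hΓ n
    rw [h2, Real.Gamma_add_natCast (by positivity), hc]
    field_simp
  rw [setLIntegral_congr Ioi_ae_eq_Ici.symm]
  have hcI : ∀ n : ℕ, 0 < (1 / θ + s) ^ (-(m + n + j)) * (1 / 2) * Real.Gamma (m + n + j) := fun n => by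
    have := Real.Gamma_pos_of_pos (by positivity : 0 < m + n + j)
    positivity
  calc
    _ = ∫⁻ x in Ioi (0 : ℝ), ∑' n, ENNReal.ofReal
          (c n * (x ^ q n * Real.exp (-(1 / θ + s) * x ^ (2 : ℝ)))) := by
      refine setLIntegral_congr_fun measurableSet_Ioi fun x hx => ?_
      have hx0 : (0 : ℝ) < x := hx
      have h2 := hterm x hx
      rw [← ENNReal.ofReal_mul (condAmplitudePDF_nonneg hm hOm hlam ht hx0.le), ← h2.tsum_eq,
        ENNReal.ofReal_tsum_of_nonneg (fun n => mul_nonneg (hc0 n) (by positivity)) h2.summable]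
    _ = ∑' n, ∫⁻ x in Ioi (0 : ℝ), ENNReal.ofReal
          (c n * (x ^ q n * Real.exp (-(1 / θ + s) * x ^ (2 : ℝ)))) :=
      lintegral_tsum fun n => by fun_prop
    _ = ∑' n, ENNReal.ofReal (Real.exp (-p) * θ ^ j * (1 + s * θ) ^ (-(m + j)) *
          (p ^ n / (n ! : ℝ) * (ascPochhammer ℝ j).eval (m + n) * (1 + s * θ)⁻¹ ^ n)) := by
      refine tsum_congr fun n => ?_
      rw [← ofReal_integral_eq_lintegral_ofReal, integral_const_mul, hint, hval]
      · refine Integrable.const_mul (Integrable.of_integral_ne_zero ?_) _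
        rw [hint]
        exact (hcI n).ne'
      · filter_upwards [ae_restrict_mem measurableSet_Ioi] with x hx
        have hx0 : (0 : ℝ) < x := hx
        exact mul_nonneg (hc0 n) (by positivity)
    _ = _ := by
      have h2 := hS.mul_left (Real.exp (-p) * θ ^ j * (1 + s * θ) ^ (-(m + j)))
      rw [← ENNReal.ofReal_tsum_of_nonneg _ h2.summable, h2.tsum_eq]
      intro n
      have := ascPochhammer_eval_nonneg (by positivity : 0 ≤ m + n) j
      positivity

/-- Up to the factor `exp p`, the expectation of a quadratic polynomial of a Poisson variable of
parameter `p`. -/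
theorem hasSum_pow_div_factorial_mul (p a b c : ℝ) :
    HasSum (fun n : ℕ => p ^ n / (n ! : ℝ) * (a + b * n + c * (n * (n - 1))))
      (Real.exp p * (a + b * p + c * p ^ 2)) := by
  have h0 : HasSum (fun n : ℕ => p ^ n / (n ! : ℝ)) (Real.exp p) := by
    rw [Real.exp_eq_exp_ℝ]
    exact NormedSpace.expSeries_div_hasSum_exp p
  have h1 : HasSum (fun n : ℕ => p ^ n / (n ! : ℝ) * n) (p * Real.exp p) := by
    rw [← hasSum_nat_add_iff' 1]
    refine hasSum_of_eq (h0.mul_left p) (fun n => ?_) (by simp)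
    rw [Nat.factorial_succ]
    push_cast
    field_simp
    ring
  have h2 : HasSum (fun n : ℕ => p ^ n / (n ! : ℝ) * (n * (n - 1))) (p ^ 2 * Real.exp p) := by
    rw [← hasSum_nat_add_iff' 2]
    refine hasSum_of_eq (h0.mul_left (p ^ 2)) (fun n => ?_) (by simp [Finset.sum_range_succ])
    rw [Nat.factorial_succ, Nat.factorial_succ]
    push_cast
    have : (n : ℝ) + 1 + 1 ≠ 0 := by positivity
    field_simp
    ring
  exact hasSum_of_eq (((h0.mul_right a).add (h1.mul_right b)).add (h2.mul_right c))
    (fun n => by ring) (by ring)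

section Conditional

open MeasureTheory Set

variable {m Om lam t : ℝ}

/-- The conditional Laplace transform of the squared amplitude. -/
theorem lintegral_condAmplitudePDF_mul_exp (hm : 0 < m) (hOm : 0 < Om) (hlam : |lam| < 1)
    (ht : 0 ≤ t) {s : ℝ} (hs : 0 ≤ s) :
    ∫⁻ x in Ici (0 : ℝ), ENNReal.ofReal (condAmplitudePDF m Om lam t x) *
        ENNReal.ofReal (Real.exp (-(s * x ^ 2))) =
      ENNReal.ofReal ((1 + s * (Om * (1 - lam ^ 2) / m)) ^ (-m) *
        Real.exp (-(lam ^ 2 / (1 - lam ^ 2) * (s * (Om * (1 - lam ^ 2) / m) /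
          (1 + s * (Om * (1 - lam ^ 2) / m))) * t))) := by
  have h1 := one_sub_sq_pos hlam
  have hσ : 0 < 1 + s * (Om * (1 - lam ^ 2) / m) := by positivity
  set p := lam ^ 2 / (1 - lam ^ 2) * t with hp
  have hS := hasSum_pow_div_factorial_mul (p * (1 + s * (Om * (1 - lam ^ 2) / m))⁻¹) 1 0 0
  have h := lintegral_condAmplitudePDF_mul hm hOm hlam ht hs 0 rfl hp
    (S := Real.exp (p * (1 + s * (Om * (1 - lam ^ 2) / m))⁻¹)) (by
      refine hasSum_of_eq hS (fun n => ?_) (by ring)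
      simp only [ascPochhammer_zero, Polynomial.eval_one, mul_pow]
      ring)
  simp only [pow_zero, one_mul, mul_one, Nat.cast_zero, add_zero] at h
  rw [h]
  congr 1
  rw [mul_right_comm, ← Real.exp_add, mul_comm]
  congr 2
  rw [hp]
  field_simp
  ring

theorem lintegral_condAmplitudePDF (hm : 0 < m) (hOm : 0 < Om) (hlam : |lam| < 1) (ht : 0 ≤ t) :
    ∫⁻ x in Ici (0 : ℝ), ENNReal.ofReal (condAmplitudePDF m Om lam t x) = 1 := by
  simpa using lintegral_condAmplitudePDF_mul_exp hm hOm hlam ht le_rfl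

theorem lintegral_condAmplitudePDF_mul_sq (hm : 0 < m) (hOm : 0 < Om) (hlam : |lam| < 1)
    (ht : 0 ≤ t) :
    ∫⁻ x in Ici (0 : ℝ), ENNReal.ofReal (condAmplitudePDF m Om lam t x) *
        ENNReal.ofReal (x ^ 2) =
      ENNReal.ofReal (Om * (1 - lam ^ 2) / m * (m + lam ^ 2 / (1 - lam ^ 2) * t)) := by
  set p := lam ^ 2 / (1 - lam ^ 2) * t with hp
  have hS := hasSum_pow_div_factorial_mul p m 1 0
  have h := lintegral_condAmplitudePDF_mul hm hOm hlam ht le_rfl 1 rfl hp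
    (S := Real.exp p * (m + p)) (by
      refine hasSum_of_eq hS (fun n => ?_) (by ring)
      simp)
  simp only [pow_one, zero_mul, neg_zero, Real.exp_zero, mul_one, add_zero, Real.one_rpow] at h
  rw [h]
  congr 1
  rw [Real.exp_neg]
  field_simp

theorem lintegral_condAmplitudePDF_mul_sq_sq (hm : 0 < m) (hOm : 0 < Om) (hlam : |lam| < 1)
    (ht : 0 ≤ t) :
    ∫⁻ x in Ici (0 : ℝ), ENNReal.ofReal (condAmplitudePDF m Om lam t x) *
        ENNReal.ofReal ((x ^ 2) ^ 2) =
      ENNReal.ofReal ((Om * (1 - lam ^ 2) / m) ^ 2 *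
        (m * (m + 1) + 2 * (m + 1) * (lam ^ 2 / (1 - lam ^ 2) * t) +
          (lam ^ 2 / (1 - lam ^ 2) * t) ^ 2)) := by
  set p := lam ^ 2 / (1 - lam ^ 2) * t with hp
  have hS := hasSum_pow_div_factorial_mul p (m * (m + 1)) (2 * (m + 1)) 1
  have h := lintegral_condAmplitudePDF_mul hm hOm hlam ht le_rfl 2 rfl hp
    (S := Real.exp p * (m * (m + 1) + 2 * (m + 1) * p + p ^ 2)) (by
      refine hasSum_of_eq hS (fun n => ?_) (by ring)
      rw [ascPochhammer_succ_eval, ascPochhammer_one, Polynomial.eval_X]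
      simp only [zero_mul, add_zero, inv_one, one_pow, Nat.cast_one]
      ring)
  simp only [zero_mul, neg_zero, Real.exp_zero, mul_one, add_zero, Real.one_rpow] at h
  rw [h]
  congr 1
  rw [Real.exp_neg]
  field_simp

end Conditional

section Mixing

open MeasureTheory Set

variable {m : ℝ}

theorem integral_mixingPDF_mul_pow (hm : 0 < m) (k : ℕ) :
    ∫ t in Ioi (0 : ℝ), mixingPDF m t * t ^ k = (ascPochhammer ℝ k).eval m := by
  have h := Real.integral_rpow_mul_exp_neg_mul_Ioi (a := m + k) (by positivity) one_pos
  rw [div_one, Real.one_rpow, one_mul, Real.Gamma_add_natCast hm] at h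
  have h1 := (Real.Gamma_pos_of_pos hm).ne'
  rw [← mul_div_cancel_right₀ ((ascPochhammer ℝ k).eval m) h1, ← h, ← integral_div]
  refine setIntegral_congr_fun measurableSet_Ioi fun t ht => ?_
  have ht' : (0 : ℝ) < t := ht
  simp only [mixingPDF]
  rw [show m + k - 1 = m - 1 + k by ring, Real.rpow_add_natCast ht'.ne', one_mul]
  ring

theorem lintegral_mixingPDF_mul_quadratic (hm : 0 < m) {a b c : ℝ} (ha : 0 ≤ a) (hb : 0 ≤ b)
    (hc : 0 ≤ c) :
    ∫⁻ t in Ioi (0 : ℝ), ENNReal.ofReal (mixingPDF m t) *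
        ENNReal.ofReal (a + b * t + c * t ^ 2) =
      ENNReal.ofReal (a + b * m + c * (m * (m + 1))) := by
  have hi : ∀ k : ℕ, IntegrableOn (fun t => mixingPDF m t * t ^ k) (Ioi 0) := fun k =>
    Integrable.of_integral_ne_zero (by
      rw [integral_mixingPDF_mul_pow hm]
      exact (ascPochhammer_pos k m hm).ne')
  have h1 : ∀ t, mixingPDF m t * (a + b * t + c * t ^ 2) = a * (mixingPDF m t * t ^ 0) +
      b * (mixingPDF m t * t ^ 1) + c * (mixingPDF m t * t ^ 2) := fun t => by ring
  have h2 : ∀ t ∈ Ioi (0 : ℝ), 0 ≤ mixingPDF m t := fun t ht =>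
    mixingPDF_nonneg hm (mem_Ioi.1 ht).le
  rw [setLIntegral_congr_fun measurableSet_Ioi (g := fun t =>
    ENNReal.ofReal (mixingPDF m t * (a + b * t + c * t ^ 2)))
    fun t ht => (ENNReal.ofReal_mul (h2 t ht)).symm, ← ofReal_integral_eq_lintegral_ofReal]
  · simp_rw [h1]
    rw [integral_add (f := fun t => a * (mixingPDF m t * t ^ 0) + b * (mixingPDF m t * t ^ 1))
      (((hi 0).const_mul a).add ((hi 1).const_mul b)) ((hi 2).const_mul c),
      integral_add ((hi 0).const_mul a) ((hi 1).const_mul b)]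
    simp_rw [integral_const_mul, integral_mixingPDF_mul_pow hm]
    have h3 : (ascPochhammer ℝ 2).eval m = m * (m + 1) := by simp [ascPochhammer_succ_eval]
    simp [h3]
  · simp_rw [h1]
    exact (((hi 0).const_mul a).add ((hi 1).const_mul b)).add ((hi 2).const_mul c)
  · filter_upwards [ae_restrict_mem measurableSet_Ioi] with t ht
    have := h2 t ht
    have ht' : (0 : ℝ) < t := ht
    simp only [Pi.zero_apply]
    positivity

theorem lintegral_mixingPDF (hm : 0 < m) :
    ∫⁻ t in Ioi (0 : ℝ), ENNReal.ofReal (mixingPDF m t) = 1 := by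
  simpa using lintegral_mixingPDF_mul_quadratic hm zero_le_one le_rfl le_rfl

theorem lintegral_mixingPDF_mul_exp (hm : 0 < m) {c : ℝ} (hc : 0 ≤ c) :
    ∫⁻ t in Ioi (0 : ℝ), ENNReal.ofReal (mixingPDF m t) * ENNReal.ofReal (Real.exp (-(c * t))) =
      ENNReal.ofReal ((1 + c) ^ (-m)) := by
  have h := Real.integral_rpow_mul_exp_neg_mul_Ioi hm (by positivity : 0 < 1 + c)
  have h1 := Real.Gamma_pos_of_pos hm
  have h2 : ∫ t in Ioi (0 : ℝ), mixingPDF m t * Real.exp (-(c * t)) = (1 + c) ^ (-m) := by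
    rw [← mul_div_cancel_right₀ ((1 + c) ^ (-m)) h1.ne', Real.rpow_neg (by positivity),
      ← Real.inv_rpow (by positivity), ← one_div, ← h, ← integral_div]
    refine setIntegral_congr_fun measurableSet_Ioi fun t ht => ?_
    simp only [mixingPDF]
    rw [show -((1 + c) * t) = -t + -(c * t) by ring, Real.exp_add]
    ring
  rw [← h2, ofReal_integral_eq_lintegral_ofReal]
  · refine setLIntegral_congr_fun measurableSet_Ioi fun t ht => ?_
    exact (ENNReal.ofReal_mul (mixingPDF_nonneg hm (mem_Ioi.1 ht).le)).symm
  · refine Integrable.of_integral_ne_zero ?_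
    rw [h2]
    positivity
  · filter_upwards [ae_restrict_mem measurableSet_Ioi] with t ht
    exact mul_nonneg (mixingPDF_nonneg hm (mem_Ioi.1 ht).le) (Real.exp_pos _).le

end Mixing

/-! ### The law of the amplitudes as a mixture of product laws -/

open MeasureTheory Set

/-- Tonelli's theorem for a product of functions of the coordinates. -/
theorem lintegral_pi_prod {M : ℕ} (f : Fin M → ℝ → ENNReal) (hf : ∀ k, Measurable (f k)) :
    ∫⁻ x : Fin M → ℝ, ∏ k, f k (x k) = ∏ k, ∫⁻ y, f k y := by
  induction M with
  | zero => simp [volume_pi]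
  | succ M ih =>
    have e := (volume_preserving_piFinSuccAbove (fun _ : Fin (M + 1) => ℝ) 0).symm
    rw [← e.lintegral_comp_emb (MeasurableEquiv.measurableEmbedding _), Fin.prod_univ_succ,
      ← ih _ fun k => hf k.succ, Measure.volume_eq_prod,
      ← lintegral_prod_mul (hf 0).aemeasurable (Measurable.aemeasurable
        (Finset.measurable_fun_prod _ fun k _ => (hf k.succ).comp (measurable_pi_apply k)))]
    refine lintegral_congr fun p => ?_
    simp [Fin.prod_univ_succ, MeasurableEquiv.piFinSuccAbove]

section Joint

variable {M : ℕ} {m : ℝ} {Om lam : Fin M → ℝ}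

theorem measurable_indicator_condAmplitudePDF (hm : 0 < m) (Om lam : ℝ) :
    Measurable fun q : ℝ × ℝ =>
      (Ici (0 : ℝ)).indicator (fun x => ENNReal.ofReal (condAmplitudePDF m Om lam q.1 x)) q.2 := by
  have h : (fun q : ℝ × ℝ => (Ici (0 : ℝ)).indicator
      (fun x => ENNReal.ofReal (condAmplitudePDF m Om lam q.1 x)) q.2) =
      (Prod.snd ⁻¹' Ici (0 : ℝ)).indicator
        fun q : ℝ × ℝ => ENNReal.ofReal (condAmplitudePDF m Om lam q.1 q.2) := by
    ext q; rfl
  rw [h]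
  exact (measurable_condAmplitudePDF hm Om lam).ennreal_ofReal.indicator
    (measurable_snd measurableSet_Ici)

/-- The joint density of the amplitudes as a function with values in `[0, ∞]`, for which the
integral over the mixing variable needs no integrability. -/
noncomputable def nakagamiMixturePDF (m : ℝ) (Om lam : Fin M → ℝ) (x : Fin M → ℝ) : ENNReal :=
  ∫⁻ t in Ioi (0 : ℝ), ENNReal.ofReal (mixingPDF m t) *
    ∏ l, (Ici (0 : ℝ)).indicator
      (fun x => ENNReal.ofReal (condAmplitudePDF m (Om l) (lam l) t x)) (x l)

theorem measurable_nakagamiMixturePDF (hm : 0 < m) (Om lam : Fin M → ℝ) :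
    Measurable (nakagamiMixturePDF m Om lam) := by
  refine Measurable.lintegral_prod_right' (f := fun q : (Fin M → ℝ) × ℝ =>
    ENNReal.ofReal (mixingPDF m q.2) * ∏ l, (Ici (0 : ℝ)).indicator
      (fun x => ENNReal.ofReal (condAmplitudePDF m (Om l) (lam l) q.2 x)) (q.1 l)) ?_
  refine (((measurable_mixingPDF m).comp measurable_snd).ennreal_ofReal).mul
    (Finset.measurable_fun_prod _ fun l _ => ?_)
  exact (measurable_indicator_condAmplitudePDF hm (Om l) (lam l)).comp
    (measurable_snd.prodMk ((measurable_pi_apply l).comp measurable_fst))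

theorem lintegral_nakagamiMixturePDF_mul_prod (hm : 0 < m) (Om lam : Fin M → ℝ) {g : Fin M → ℝ → ENNReal}
    (hg : ∀ l, Measurable (g l)) :
    ∫⁻ x : Fin M → ℝ, nakagamiMixturePDF m Om lam x * ∏ l, g l (x l) =
      ∫⁻ t in Ioi (0 : ℝ), ENNReal.ofReal (mixingPDF m t) *
        ∏ l, ∫⁻ x in Ici (0 : ℝ),
          ENNReal.ofReal (condAmplitudePDF m (Om l) (lam l) t x) * g l x := by
  have hk := fun l => measurable_indicator_condAmplitudePDF hm (Om l) (lam l)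
  have hmeas : Measurable fun q : (Fin M → ℝ) × ℝ => ENNReal.ofReal (mixingPDF m q.2) *
      (∏ l, (Ici (0 : ℝ)).indicator
        (fun x => ENNReal.ofReal (condAmplitudePDF m (Om l) (lam l) q.2 x)) (q.1 l)) *
        ∏ l, g l (q.1 l) := by
    refine ((((measurable_mixingPDF m).comp measurable_snd).ennreal_ofReal).mul
      (Finset.measurable_fun_prod _ fun l _ => ?_)).mul
      (Finset.measurable_fun_prod _ fun l _ => ?_)
    · exact (hk l).comp (measurable_snd.prodMk ((measurable_pi_apply l).comp measurable_fst))
    · exact (hg l).comp ((measurable_pi_apply l).comp measurable_fst)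
  have hsec : ∀ x : Fin M → ℝ, Measurable fun t => ENNReal.ofReal (mixingPDF m t) *
      ∏ l, (Ici (0 : ℝ)).indicator
        (fun x => ENNReal.ofReal (condAmplitudePDF m (Om l) (lam l) t x)) (x l) := fun x =>
    (measurable_mixingPDF m).ennreal_ofReal.mul (Finset.measurable_fun_prod _ fun l _ =>
      (hk l).comp (measurable_id.prodMk measurable_const))
  simp_rw [nakagamiMixturePDF, ← lintegral_mul_const _ (hsec _)]
  rw [lintegral_lintegral_swap (by exact hmeas.aemeasurable)]
  refine lintegral_congr fun t => ?_
  have hkt : ∀ l, Measurable ((Ici (0 : ℝ)).indicator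
      fun x => ENNReal.ofReal (condAmplitudePDF m (Om l) (lam l) t x)) := fun l =>
    (hk l).comp (measurable_const.prodMk measurable_id)
  simp_rw [mul_assoc, ← Finset.prod_mul_distrib]
  have hprod : Measurable fun x : Fin M → ℝ => ∏ l, (Ici (0 : ℝ)).indicator
      (fun x => ENNReal.ofReal (condAmplitudePDF m (Om l) (lam l) t x)) (x l) * g l (x l) :=
    Finset.measurable_fun_prod _ fun l _ =>
      ((hkt l).comp (measurable_pi_apply l)).mul ((hg l).comp (measurable_pi_apply l))
  rw [lintegral_const_mul _ hprod, lintegral_pi_prod (fun l x => (Ici (0 : ℝ)).indicator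
    (fun x => ENNReal.ofReal (condAmplitudePDF m (Om l) (lam l) t x)) x * g l x)
    fun l => (hkt l).mul (hg l)]
  congr 1
  refine Finset.prod_congr rfl fun l _ => ?_
  rw [← lintegral_indicator measurableSet_Ici]
  refine lintegral_congr fun x => ?_
  simp only [Set.indicator_apply]
  split_ifs <;> simp

/-- Where the mixture integral is finite, which is almost everywhere since the total mass is one,
the Bochner integral defining the joint density agrees with the integral in `[0, ∞]`. -/
theorem ofReal_nakagamiJointPDF_ae_eq (hm : 0 < m) (hOm : ∀ l, 0 < Om l)
    (hlam : ∀ l, |lam l| < 1) :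
    (fun x => ENNReal.ofReal (nakagamiJointPDF m Om lam x)) =ᵐ[volume]
      nakagamiMixturePDF m Om lam := by
  have hmeas := measurable_nakagamiMixturePDF hm Om lam
  -- The test functions `g = 1` show that the total mass is one.
  have hmass := lintegral_nakagamiMixturePDF_mul_prod (M := M) hm Om lam (g := fun _ _ => 1)
    fun _ => measurable_const
  simp only [Finset.prod_const_one, mul_one] at hmass
  rw [setLIntegral_congr_fun (g := fun t => ENNReal.ofReal (mixingPDF m t)) measurableSet_Ioi
    fun t ht => by
      simp [lintegral_condAmplitudePDF hm (hOm _) (hlam _) (mem_Ioi.1 ht).le],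
    lintegral_mixingPDF hm] at hmass
  filter_upwards [ae_lt_top hmeas (by rw [hmass]; exact ENNReal.one_ne_top)] with x hx
  rw [nakagamiMixturePDF] at hx ⊢
  by_cases h : ∀ l, 0 ≤ x l
  · have heq : ∀ t ∈ Ioi (0 : ℝ), ENNReal.ofReal (mixingPDF m t) * ∏ l, (Ici (0 : ℝ)).indicator
        (fun x => ENNReal.ofReal (condAmplitudePDF m (Om l) (lam l) t x)) (x l) =
        ENNReal.ofReal (mixingPDF m t * ∏ l, condAmplitudePDF m (Om l) (lam l) t (x l)) := by
      intro t ht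
      have ht' := (mem_Ioi.1 ht).le
      rw [ENNReal.ofReal_mul (mixingPDF_nonneg hm ht'), ENNReal.ofReal_prod_of_nonneg fun l _ =>
        condAmplitudePDF_nonneg hm (hOm l) (hlam l) ht' (h l)]
      congr 1
      exact Finset.prod_congr rfl fun l _ => indicator_of_mem (h l) _
    rw [setLIntegral_congr_fun measurableSet_Ioi heq] at hx ⊢
    have hpdf : nakagamiJointPDF m Om lam x = ∫ t in Ioi (0 : ℝ),
        mixingPDF m t * ∏ l, condAmplitudePDF m (Om l) (lam l) t (x l) := if_pos h
    rw [hpdf, integral_eq_lintegral_of_nonneg_ae, ENNReal.ofReal_toReal hx.ne]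
    · filter_upwards [ae_restrict_mem measurableSet_Ioi] with t ht
      have ht' := (mem_Ioi.1 ht).le
      exact mul_nonneg (mixingPDF_nonneg hm ht') (Finset.prod_nonneg fun l _ =>
        condAmplitudePDF_nonneg hm (hOm l) (hlam l) ht' (h l))
    · exact ((measurable_mixingPDF m).mul (Finset.measurable_fun_prod _ fun l _ =>
        (measurable_condAmplitudePDF hm (Om l) (lam l)).comp
          (measurable_id.prodMk measurable_const))).aestronglyMeasurable
  · have hpdf : nakagamiJointPDF m Om lam x = 0 := if_neg h
    push Not at h
    obtain ⟨l, hl⟩ := h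
    rw [hpdf, ENNReal.ofReal_zero]
    symm
    rw [lintegral_eq_zero_of_ae_eq_zero]
    refine Filter.Eventually.of_forall fun t => ?_
    exact mul_eq_zero_of_right _ (Finset.prod_eq_zero (Finset.mem_univ l)
      (indicator_of_notMem (by simpa using hl) _))

variable {S : Type*} [MeasurableSpace S] {μ : Measure S} {h : Fin M → S → ℂ}

/-- Given the mixing variable, the amplitudes are independent. -/
theorem HasNakagamiAmplitudes.lintegral_prod (hlaw : HasNakagamiAmplitudes μ m Om lam h)
    (hh : ∀ l, Measurable (h l)) (hm : 0 < m) (hOm : ∀ l, 0 < Om l) (hlam : ∀ l, |lam l| < 1)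
    {g : Fin M → ℝ → ENNReal} (hg : ∀ l, Measurable (g l)) :
    ∫⁻ s, ∏ l, g l ‖h l s‖ ∂μ =
      ∫⁻ t in Ioi (0 : ℝ), ENNReal.ofReal (mixingPDF m t) *
        ∏ l, ∫⁻ x in Ici (0 : ℝ),
          ENNReal.ofReal (condAmplitudePDF m (Om l) (lam l) t x) * g l x := by
  have hgm : Measurable fun x : Fin M → ℝ => ∏ l, g l (x l) :=
    Finset.measurable_fun_prod _ fun l _ => (hg l).comp (measurable_pi_apply l)
  have hae := ofReal_nakagamiJointPDF_ae_eq hm hOm hlam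
  have hmeas := measurable_nakagamiMixturePDF hm Om lam
  rw [← lintegral_nakagamiMixturePDF_mul_prod hm Om lam hg,
    ← lintegral_map (f := fun x : Fin M → ℝ => ∏ l, g l (x l)) hgm
      (measurable_pi_lambda _ fun l => (hh l).norm),
    show μ.map (fun s l => ‖h l s‖) = _ from hlaw, withDensity_congr_ae hae,
    lintegral_withDensity_eq_lintegral_mul _ hmeas hgm]
  rfl

/-- The joint Laplace transform of the squared amplitudes. -/
theorem HasNakagamiAmplitudes.lintegral_exp (hlaw : HasNakagamiAmplitudes μ m Om lam h)
    (hh : ∀ l, Measurable (h l)) (hm : 0 < m) (hOm : ∀ l, 0 < Om l) (hlam : ∀ l, |lam l| < 1)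
    {a : Fin M → ℝ} (ha : ∀ l, 0 ≤ a l) :
    ∫⁻ s, ENNReal.ofReal (Real.exp (-∑ l, a l * ‖h l s‖ ^ 2)) ∂μ =
      ENNReal.ofReal (((∏ l, (1 + a l * (Om l * (1 - lam l ^ 2) / m))) *
        (1 + ∑ l, lam l ^ 2 / (1 - lam l ^ 2) * (a l * (Om l * (1 - lam l ^ 2) / m) /
          (1 + a l * (Om l * (1 - lam l ^ 2) / m))))) ^ (-m)) := by
  have hθ : ∀ l, 0 ≤ a l * (Om l * (1 - lam l ^ 2) / m) := fun l => by
    have := one_sub_sq_pos (hlam l)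
    have := ha l
    have := hOm l
    positivity
  have hc : 0 ≤ ∑ l, lam l ^ 2 / (1 - lam l ^ 2) * (a l * (Om l * (1 - lam l ^ 2) / m) /
      (1 + a l * (Om l * (1 - lam l ^ 2) / m))) := Finset.sum_nonneg fun l _ => by
    have := one_sub_sq_pos (hlam l)
    have := hθ l
    positivity
  have hP : 0 < ∏ l, (1 + a l * (Om l * (1 - lam l ^ 2) / m)) := Finset.prod_pos fun l _ => by
    have := hθ l
    positivity
  have h1 : ∀ s, ENNReal.ofReal (Real.exp (-∑ l, a l * ‖h l s‖ ^ 2)) =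
      ∏ l, ENNReal.ofReal (Real.exp (-(a l * ‖h l s‖ ^ 2))) := fun s => by
    rw [← Finset.sum_neg_distrib, Real.exp_sum,
      ENNReal.ofReal_prod_of_nonneg fun _ _ => (Real.exp_pos _).le]
  simp_rw [h1]
  rw [hlaw.lintegral_prod hh hm hOm hlam
    (g := fun l x => ENNReal.ofReal (Real.exp (-(a l * x ^ 2)))) fun l => by fun_prop]
  rw [Real.mul_rpow hP.le (by positivity), ENNReal.ofReal_mul (by positivity),
    ← lintegral_mixingPDF_mul_exp hm hc, ← lintegral_const_mul' _ _ ENNReal.ofReal_ne_top]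
  refine setLIntegral_congr_fun measurableSet_Ioi fun t ht => ?_
  simp only [lintegral_condAmplitudePDF_mul_exp hm (hOm _) (hlam _) (mem_Ioi.1 ht).le (ha _)]
  rw [← ENNReal.ofReal_prod_of_nonneg fun l _ => by have := hθ l; positivity,
    Finset.prod_mul_distrib, ← Real.exp_sum, Finset.sum_neg_distrib, ← Finset.sum_mul,
    Real.finsetProd_rpow _ _ fun l _ => by have := hθ l; positivity,
    ENNReal.ofReal_mul (by positivity)]
  ring

theorem HasNakagamiAmplitudes.lintegral_sq (hlaw : HasNakagamiAmplitudes μ m Om lam h)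
    (hh : ∀ l, Measurable (h l)) (hm : 0 < m) (hOm : ∀ l, 0 < Om l) (hlam : ∀ l, |lam l| < 1)
    (l : Fin M) : ∫⁻ s, ENNReal.ofReal (‖h l s‖ ^ 2) ∂μ = ENNReal.ofReal (Om l) := by
  have hl := one_sub_sq_pos (hlam l)
  have hO := hOm l
  have h1 := hlaw.lintegral_prod hh hm hOm hlam
    (g := fun k x => if k = l then ENNReal.ofReal (x ^ 2) else 1)
    fun k => by split_ifs <;> fun_prop
  simp only [Finset.prod_ite_eq', Finset.mem_univ, if_true] at h1
  rw [h1, setLIntegral_congr_fun (g := fun t => ENNReal.ofReal (mixingPDF m t) *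
    ENNReal.ofReal (Om l * (1 - lam l ^ 2) + Om l * lam l ^ 2 / m * t + 0 * t ^ 2))
    measurableSet_Ioi fun t ht => ?_, lintegral_mixingPDF_mul_quadratic hm (by positivity)
      (by positivity) le_rfl]
  · congr 1
    field_simp
    ring
  · simp only []
    rw [Fintype.prod_eq_single l fun k hk => by
      simp [hk, lintegral_condAmplitudePDF hm (hOm _) (hlam _) (mem_Ioi.1 ht).le]]
    simp only [if_true]
    rw [lintegral_condAmplitudePDF_mul_sq hm hO (hlam l) (mem_Ioi.1 ht).le]
    congr 2
    field_simp
    ring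

theorem HasNakagamiAmplitudes.lintegral_sq_sq (hlaw : HasNakagamiAmplitudes μ m Om lam h)
    (hh : ∀ l, Measurable (h l)) (hm : 0 < m) (hOm : ∀ l, 0 < Om l) (hlam : ∀ l, |lam l| < 1)
    (l : Fin M) : ∫⁻ s, ENNReal.ofReal ((‖h l s‖ ^ 2) ^ 2) ∂μ =
      ENNReal.ofReal (Om l ^ 2 + Om l ^ 2 / m) := by
  have hl := one_sub_sq_pos (hlam l)
  have hO := hOm l
  have h1 := hlaw.lintegral_prod hh hm hOm hlam
    (g := fun k x => if k = l then ENNReal.ofReal ((x ^ 2) ^ 2) else 1)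
    fun k => by split_ifs <;> fun_prop
  simp only [Finset.prod_ite_eq', Finset.mem_univ, if_true] at h1
  rw [h1, setLIntegral_congr_fun (g := fun t => ENNReal.ofReal (mixingPDF m t) *
    ENNReal.ofReal ((Om l * (1 - lam l ^ 2)) ^ 2 * (m + 1) / m +
      2 * (m + 1) * Om l ^ 2 * (1 - lam l ^ 2) * lam l ^ 2 / m ^ 2 * t +
      Om l ^ 2 * (lam l ^ 2) ^ 2 / m ^ 2 * t ^ 2))
    measurableSet_Ioi fun t ht => ?_, lintegral_mixingPDF_mul_quadratic hm (by positivity)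
      (by positivity) (by positivity)]
  · congr 1
    field_simp
    ring
  · simp only []
    rw [Fintype.prod_eq_single l fun k hk => by
      simp [hk, lintegral_condAmplitudePDF hm (hOm _) (hlam _) (mem_Ioi.1 ht).le]]
    simp only [if_true]
    rw [lintegral_condAmplitudePDF_mul_sq_sq hm hO (hlam l) (mem_Ioi.1 ht).le]
    congr 2
    field_simp

theorem HasNakagamiAmplitudes.lintegral_sq_mul_sq (hlaw : HasNakagamiAmplitudes μ m Om lam h)
    (hh : ∀ l, Measurable (h l)) (hm : 0 < m) (hOm : ∀ l, 0 < Om l) (hlam : ∀ l, |lam l| < 1)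
    {l k : Fin M} (hlk : l ≠ k) : ∫⁻ s, ENNReal.ofReal (‖h l s‖ ^ 2 * ‖h k s‖ ^ 2) ∂μ =
      ENNReal.ofReal (Om l * Om k + Om l * Om k * (lam l ^ 2 * lam k ^ 2) / m) := by
  have hl := one_sub_sq_pos (hlam l)
  have hk := one_sub_sq_pos (hlam k)
  have hOl := hOm l
  have hOk := hOm k
  have h1 := hlaw.lintegral_prod hh hm hOm hlam
    (g := fun i x => if i = l ∨ i = k then ENNReal.ofReal (x ^ 2) else 1)
    fun i => by split_ifs <;> fun_prop
  have h2 : ∀ s, ENNReal.ofReal (‖h l s‖ ^ 2 * ‖h k s‖ ^ 2) =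
      ∏ i, if i = l ∨ i = k then ENNReal.ofReal (‖h i s‖ ^ 2) else 1 := fun s => by
    rw [Fintype.prod_eq_mul l k hlk fun i hi => by simp [hi.1, hi.2]]
    simp [ENNReal.ofReal_mul]
  simp_rw [h2]
  rw [h1, setLIntegral_congr_fun (g := fun t => ENNReal.ofReal (mixingPDF m t) *
    ENNReal.ofReal (Om l * (1 - lam l ^ 2) * (Om k * (1 - lam k ^ 2)) +
      (Om l * (1 - lam l ^ 2) * (Om k * lam k ^ 2) / m +
        Om l * lam l ^ 2 * (Om k * (1 - lam k ^ 2)) / m) * t +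
      Om l * lam l ^ 2 * (Om k * lam k ^ 2) / m ^ 2 * t ^ 2))
    measurableSet_Ioi fun t ht => ?_, lintegral_mixingPDF_mul_quadratic hm (by positivity)
      (by positivity) (by positivity)]
  · congr 1
    field_simp
    ring
  · have ht' := (mem_Ioi.1 ht).le
    simp only []
    rw [Fintype.prod_eq_mul l k hlk fun i hi => by
      simp [hi.1, hi.2, lintegral_condAmplitudePDF hm (hOm _) (hlam _) ht']]
    simp only [true_or, or_true, if_true]
    rw [lintegral_condAmplitudePDF_mul_sq hm hOl (hlam l) ht',
      lintegral_condAmplitudePDF_mul_sq hm hOk (hlam k) ht', ← ENNReal.ofReal_mul (by positivity)]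
    congr 2
    field_simp
    ring

/-- The correlation coefficient of the squared amplitudes is `lam l ^ 2 * lam k ^ 2`. -/
theorem HasNakagamiAmplitudes.powerCorr_eq [IsProbabilityMeasure μ]
    (hlaw : HasNakagamiAmplitudes μ m Om lam h)
    (hh : ∀ l, Measurable (h l)) (hm : 0 < m) (hOm : ∀ l, 0 < Om l) (hlam : ∀ l, |lam l| < 1)
    {l k : Fin M} (hlk : l ≠ k) : powerCorr μ h l k = lam l ^ 2 * lam k ^ 2 := by
  have hE : ∀ i, ∫ s, ‖h i s‖ ^ 2 ∂μ = Om i := fun i => by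
    rw [integral_eq_lintegral_of_nonneg_ae (Filter.Eventually.of_forall fun s => by positivity)
      (((hh i).norm.pow_const 2).aestronglyMeasurable),
      hlaw.lintegral_sq hh hm hOm hlam, ENNReal.toReal_ofReal (hOm i).le]
  have hE2 : ∀ i, ∫ s, (‖h i s‖ ^ 2) ^ 2 ∂μ = Om i ^ 2 + Om i ^ 2 / m := fun i => by
    rw [integral_eq_lintegral_of_nonneg_ae (Filter.Eventually.of_forall fun s => by positivity)
      ((((hh i).norm.pow_const 2).pow_const 2).aestronglyMeasurable),
      hlaw.lintegral_sq_sq hh hm hOm hlam, ENNReal.toReal_ofReal (by positivity)]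
  have hEE : ∫ s, ‖h l s‖ ^ 2 * ‖h k s‖ ^ 2 ∂μ =
      Om l * Om k + Om l * Om k * (lam l ^ 2 * lam k ^ 2) / m := by
    have := hOm l
    have := hOm k
    rw [integral_eq_lintegral_of_nonneg_ae (Filter.Eventually.of_forall fun s => by positivity)
      (by fun_prop : Measurable fun s => ‖h l s‖ ^ 2 * ‖h k s‖ ^ 2).aestronglyMeasurable,
      hlaw.lintegral_sq_mul_sq hh hm hOm hlam hlk, ENNReal.toReal_ofReal (by positivity)]
  have hV : ∀ i, ProbabilityTheory.variance (fun s => ‖h i s‖ ^ 2) μ = Om i ^ 2 / m := fun i => by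
    have hO := hOm i
    rw [ProbabilityTheory.variance_eq_sub, hE]
    · simp only [Pi.pow_apply, hE2]
      ring
    · rw [memLp_two_iff_integrable_sq ((hh i).norm.pow_const 2).aestronglyMeasurable]
      refine Integrable.of_integral_ne_zero ?_
      rw [hE2]
      positivity
  have hOl := hOm l
  have hOk := hOm k
  rw [powerCorr, hEE, hE, hE, hV, hV,
    show Om l ^ 2 / m * (Om k ^ 2 / m) = (Om l * Om k / m) ^ 2 by ring,
    Real.sqrt_sq (by positivity)]
  field_simp
  ring

end Joint

/-! ### The matrices `E` and `B` -/

section Matrices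

variable {M : ℕ}

/-- The matrix determinant lemma for an update of a diagonal matrix by two rank one matrices whose
vectors have disjoint supports. -/
theorem det_diagonal_add_diagonal_mul_vecMulVec {w a u v : Fin M → ℝ} (hw : ∀ l, w l ≠ 0)
    (huv : ∀ l, u l * v l = 0) :
    (Matrix.diagonal w + Matrix.diagonal a * (Matrix.vecMulVec u u + Matrix.vecMulVec v v)).det =
      (∏ l, w l) * ((1 + ∑ l, a l * u l ^ 2 / w l) * (1 + ∑ l, a l * v l ^ 2 / w l)) := by
  have h1 : Matrix.diagonal a * (Matrix.vecMulVec u u + Matrix.vecMulVec v v) =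
      (Matrix.of fun l (j : Fin 2) => a l * ![u, v] j l) * Matrix.of ![u, v] := by
    ext l k
    rw [Matrix.diagonal_mul]
    simp [Matrix.mul_apply, Fin.sum_univ_two, Matrix.vecMulVec_apply]
    ring
  have hdet : IsUnit (Matrix.diagonal w).det := by
    rw [Matrix.det_diagonal]
    exact (Finset.prod_ne_zero_iff.2 fun l _ => hw l).isUnit
  have hinv : (Matrix.diagonal w)⁻¹ = Matrix.diagonal fun l => (w l)⁻¹ := by
    refine Matrix.inv_eq_right_inv ?_
    rw [Matrix.diagonal_mul_diagonal, ← Matrix.diagonal_one]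
    congr 1
    ext l
    exact mul_inv_cancel₀ (hw l)
  have hoff : ∀ l, u l * (w l)⁻¹ * (a l * v l) = 0 := fun l => by
    linear_combination (w l)⁻¹ * a l * huv l
  have hoff' : ∀ l, v l * (w l)⁻¹ * (a l * u l) = 0 := fun l => by
    linear_combination (w l)⁻¹ * a l * huv l
  have hd : ∀ z : Fin M → ℝ, ∑ l, z l * (w l)⁻¹ * (a l * z l) = ∑ l, a l * z l ^ 2 / w l :=
    fun z => Finset.sum_congr rfl fun l _ => by ring
  have hentry : ∀ i j, ((Matrix.of ![u, v] * Matrix.diagonal fun l => (w l)⁻¹) *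
      Matrix.of fun l (j : Fin 2) => a l * ![u, v] j l) i j =
      ∑ l, ![u, v] i l * (w l)⁻¹ * (a l * ![u, v] j l) := fun i j => by
    rw [Matrix.mul_apply]
    simp only [Matrix.mul_diagonal, Matrix.of_apply]
  rw [h1, Matrix.det_add_mul _ _ hdet, Matrix.det_diagonal, hinv, Matrix.det_fin_two]
  simp only [Matrix.add_apply, hentry]
  simp [hoff, hoff', hd]

theorem IsEigenvalueList.det_one_add_smul {B : Matrix (Fin M) (Fin M) ℝ} {δ : Fin M → ℝ}
    (h : IsEigenvalueList B δ) {x : ℝ} (hx : x ≠ 0) :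
    (1 + x • B).det = ∏ k, (1 + x * δ k) := by
  have h1 : 1 + x • B = (-x) • (Matrix.scalar (Fin M) (-x⁻¹) - B) := by
    ext i j
    rcases eq_or_ne i j with rfl | hij
    · simp [mul_sub, hx]
    · simp [hij]
  have h2 := congrArg (Polynomial.eval (-x⁻¹)) h
  rw [Matrix.eval_charpoly, Polynomial.eval_prod] at h2
  rw [h1, Matrix.det_smul, h2, Fintype.card_fin, ← Fin.prod_const, ← Finset.prod_mul_distrib]
  refine Finset.prod_congr rfl fun k _ => ?_
  simp
  field_simp
  ring

theorem IsEigenvalueList.det_eq {B : Matrix (Fin M) (Fin M) ℝ} {δ : Fin M → ℝ}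
    (h : IsEigenvalueList B δ) : B.det = ∏ k, δ k := by
  have h2 := congrArg (Polynomial.eval 0) h
  rw [Matrix.eval_charpoly, Polynomial.eval_prod] at h2
  simp only [map_zero, zero_sub, Matrix.det_neg, Fintype.card_fin, Polynomial.eval_sub,
    Polynomial.eval_X, Polynomial.eval_C, Finset.prod_neg, Finset.card_univ] at h2
  exact mul_left_cancel₀ (pow_ne_zero _ (by norm_num)) h2

/-- The product of a positive diagonal matrix and a positive definite matrix is similar to a
positive definite matrix. -/
theorem exists_isEigenvalueList_diagonal_mul {f : Fin M → ℝ} (hf : ∀ l, 0 < f l)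
    {E : Matrix (Fin M) (Fin M) ℝ} (hE : E.PosDef) :
    ∃ δ : Fin M → ℝ, (∀ k, 0 < δ k) ∧ IsEigenvalueList (Matrix.diagonal f * E) δ := by
  -- `diagonal f * E = D * (D * E)` has the characteristic polynomial of `D * E * D`.
  set D : Matrix (Fin M) (Fin M) ℝ := Matrix.diagonal fun l => √(f l) with hD
  have hDD : Matrix.diagonal f = D * D := by
    rw [hD, Matrix.diagonal_mul_diagonal]
    congr 1
    ext l
    exact (Real.mul_self_sqrt (hf l).le).symm
  have hDu : Function.Injective D.mulVec := by
    rw [Matrix.mulVec_injective_iff_isUnit, Matrix.isUnit_iff_isUnit_det, hD, Matrix.det_diagonal]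
    exact (Finset.prod_ne_zero_iff.2 fun l _ => (Real.sqrt_pos.2 (hf l)).ne').isUnit
  have hpd : (D * E * D).PosDef := by
    have h := hE.conjTranspose_mul_mul_same hDu
    rwa [show D.conjTranspose = D by rw [hD, Matrix.diagonal_conjTranspose]; rfl] at h
  refine ⟨hpd.isHermitian.eigenvalues, hpd.eigenvalues_pos, ?_⟩
  rw [IsEigenvalueList, hDD, Matrix.mul_assoc, Matrix.charpoly_mul_comm]
  exact hpd.isHermitian.charpoly_eq

theorem IsEigenvalueList.pos {B : Matrix (Fin M) (Fin M) ℝ} {δ δ' : Fin M → ℝ}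
    (h : IsEigenvalueList B δ) (h' : IsEigenvalueList B δ') (hδ' : ∀ k, 0 < δ' k) (k : Fin M) :
    0 < δ k := by
  have h1 := congrArg (Polynomial.eval (δ k)) (h.symm.trans h')
  rw [Polynomial.eval_prod, Polynomial.eval_prod,
    Finset.prod_eq_zero (Finset.mem_univ k) (by simp)] at h1
  obtain ⟨i, -, hi⟩ := Finset.prod_eq_zero_iff.1 h1.symm
  have h2 : δ k = δ' i := by simpa [sub_eq_zero] using hi
  exact h2 ▸ hδ' i

variable (r : ℕ) (lamSD lamRD : Fin M → ℝ)

/-- Off the diagonal `E` is the sum of two rank one matrices, one for each link. -/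
theorem corrMatrix_eq {ρSD ρRD : Fin M → Fin M → ℝ}
    (hSD : ∀ l k, l ≠ k → ρSD l k = lamSD l ^ 2 * lamSD k ^ 2)
    (hRD : ∀ l k, l ≠ k → ρRD l k = lamRD l ^ 2 * lamRD k ^ 2) :
    corrMatrix r ρSD ρRD =
      Matrix.diagonal (fun l : Fin M => 1 - (if (l : ℕ) < r then lamSD l else lamRD l) ^ 2) +
        (Matrix.vecMulVec (fun l : Fin M => if (l : ℕ) < r then |lamSD l| else 0)
            (fun l : Fin M => if (l : ℕ) < r then |lamSD l| else 0) +
          Matrix.vecMulVec (fun l : Fin M => if (l : ℕ) < r then 0 else |lamRD l|)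
            (fun l : Fin M => if (l : ℕ) < r then 0 else |lamRD l|)) := by
  have hsq : ∀ x y : ℝ, √(x ^ 2 * y ^ 2) = |x| * |y| := fun x y => by
    rw [← mul_pow, Real.sqrt_sq_eq_abs, abs_mul]
  ext l k
  rcases eq_or_ne l k with rfl | hlk
  · simp only [corrMatrix, Matrix.of_apply, if_true, Matrix.add_apply, Matrix.diagonal_apply_eq,
      Matrix.vecMulVec_apply]
    split_ifs <;> · simp only [abs_mul_abs_self]; ring
  · simp only [corrMatrix, Matrix.of_apply, Matrix.add_apply, Matrix.diagonal_apply_ne _ hlk,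
      Matrix.vecMulVec_apply, hSD l k hlk, hRD l k hlk, hsq, hlk, if_false]
    have h3 : ∀ i : Fin M, r ≤ i ↔ ¬ (i : ℕ) < r := fun i => not_lt.symm
    by_cases h1 : (l : ℕ) < r <;> by_cases h2 : (k : ℕ) < r <;> simp only [h3, h1, h2] <;> simp

variable {r lamSD lamRD}

theorem posDef_corrMatrix {ρSD ρRD : Fin M → Fin M → ℝ}
    (hSD : ∀ l k, l ≠ k → ρSD l k = lamSD l ^ 2 * lamSD k ^ 2)
    (hRD : ∀ l k, l ≠ k → ρRD l k = lamRD l ^ 2 * lamRD k ^ 2)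
    (hlamSD : ∀ l, |lamSD l| < 1) (hlamRD : ∀ l, |lamRD l| < 1) :
    (corrMatrix r ρSD ρRD).PosDef := by
  rw [corrMatrix_eq r lamSD lamRD hSD hRD]
  refine (Matrix.PosDef.diagonal fun l => ?_).add_posSemidef
    ((Matrix.posSemidef_vecMulVec_self_star _).add (Matrix.posSemidef_vecMulVec_self_star _))
  split_ifs
  exacts [one_sub_sq_pos (hlamSD l), one_sub_sq_pos (hlamRD l)]

/-- The product of the joint Laplace transforms of the two links, each restricted to the SNRs that
occur in the sum, is a power of `det (1 + x F E)`. -/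
theorem det_one_add_smul_gainMatrix_mul_corrMatrix {ρSD ρRD : Fin M → Fin M → ℝ}
    (hSD : ∀ l k, l ≠ k → ρSD l k = lamSD l ^ 2 * lamSD k ^ 2)
    (hRD : ∀ l k, l ≠ k → ρRD l k = lamRD l ^ 2 * lamRD k ^ 2)
    (hlamSD : ∀ l, |lamSD l| < 1) (hlamRD : ∀ l, |lamRD l| < 1)
    {m : ℝ} (hm : 0 < m) {OmSD OmRD : Fin M → ℝ} (hOmSD : ∀ l, 0 < OmSD l)
    (hOmRD : ∀ l, 0 < OmRD l) {x : ℝ} (hx : 0 ≤ x) {a b : Fin M → ℝ}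
    (ha : a = fun l : Fin M => if (l : ℕ) < r then x else 0)
    (hb : b = fun l : Fin M => if (l : ℕ) < r then 0 else x) :
    (1 + x • (gainMatrix r m OmSD OmRD * corrMatrix r ρSD ρRD)).det =
      ((∏ l, (1 + a l * (OmSD l * (1 - lamSD l ^ 2) / m))) *
        (1 + ∑ l, lamSD l ^ 2 / (1 - lamSD l ^ 2) * (a l * (OmSD l * (1 - lamSD l ^ 2) / m) /
          (1 + a l * (OmSD l * (1 - lamSD l ^ 2) / m))))) *
      ((∏ l, (1 + b l * (OmRD l * (1 - lamRD l ^ 2) / m))) *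
        (1 + ∑ l, lamRD l ^ 2 / (1 - lamRD l ^ 2) * (b l * (OmRD l * (1 - lamRD l ^ 2) / m) /
          (1 + b l * (OmRD l * (1 - lamRD l ^ 2) / m))))) := by
  set u : Fin M → ℝ := fun l => if (l : ℕ) < r then |lamSD l| else 0 with hu
  set v : Fin M → ℝ := fun l => if (l : ℕ) < r then 0 else |lamRD l| with hv
  set f : Fin M → ℝ := fun l => if (l : ℕ) < r then OmSD l / m else OmRD l / m with hf
  set d : Fin M → ℝ := fun l => 1 - (if (l : ℕ) < r then lamSD l else lamRD l) ^ 2 with hd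
  have hdpos : ∀ l, 0 < d l := fun l => by
    simp only [hd]
    split_ifs
    exacts [one_sub_sq_pos (hlamSD l), one_sub_sq_pos (hlamRD l)]
  have hfpos : ∀ l, 0 < f l := fun l => by
    have := hOmSD l
    have := hOmRD l
    simp only [hf]
    split_ifs <;> positivity
  have hw : ∀ l, 1 + x * f l * d l ≠ 0 := fun l => by
    have := hdpos l
    have := hfpos l
    positivity
  have hmat : 1 + x • (gainMatrix r m OmSD OmRD * corrMatrix r ρSD ρRD) =
      Matrix.diagonal (fun l => 1 + x * f l * d l) +
        Matrix.diagonal (fun l => x * f l) * (Matrix.vecMulVec u u + Matrix.vecMulVec v v) := by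
    rw [corrMatrix_eq r lamSD lamRD hSD hRD, gainMatrix, Matrix.mul_add, smul_add, ← add_assoc,
      Matrix.diagonal_mul_diagonal, ← Matrix.smul_mul, ← Matrix.diagonal_one,
      ← Matrix.diagonal_smul, ← Matrix.diagonal_smul, Matrix.diagonal_add]
    congr 2
    ext l
    simp [hf, hd, mul_assoc]
  rw [hmat, det_diagonal_add_diagonal_mul_vecMulVec hw fun l => by
    simp only [hu, hv]; split_ifs <;> simp]
  have hprod : ∏ l, (1 + x * f l * d l) = (∏ l, (1 + a l * (OmSD l * (1 - lamSD l ^ 2) / m))) *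
      ∏ l, (1 + b l * (OmRD l * (1 - lamRD l ^ 2) / m)) := by
    rw [← Finset.prod_mul_distrib]
    refine Finset.prod_congr rfl fun l _ => ?_
    simp only [ha, hb, hf, hd]
    split_ifs <;> ring
  have hsumSD : ∑ l, x * f l * u l ^ 2 / (1 + x * f l * d l) =
      ∑ l, lamSD l ^ 2 / (1 - lamSD l ^ 2) * (a l * (OmSD l * (1 - lamSD l ^ 2) / m) /
        (1 + a l * (OmSD l * (1 - lamSD l ^ 2) / m))) := by
    refine Finset.sum_congr rfl fun l _ => ?_
    have h1 := one_sub_sq_pos (hlamSD l)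
    simp only [ha, hu, hf, hd]
    split_ifs
    · rw [sq_abs, show x * (OmSD l / m) * (1 - lamSD l ^ 2) = x * (OmSD l * (1 - lamSD l ^ 2) / m)
        by ring]
      field_simp
    · simp
  have hsumRD : ∑ l, x * f l * v l ^ 2 / (1 + x * f l * d l) =
      ∑ l, lamRD l ^ 2 / (1 - lamRD l ^ 2) * (b l * (OmRD l * (1 - lamRD l ^ 2) / m) /
        (1 + b l * (OmRD l * (1 - lamRD l ^ 2) / m))) := by
    refine Finset.sum_congr rfl fun l _ => ?_
    have h1 := one_sub_sq_pos (hlamRD l)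
    simp only [hb, hv, hf, hd]
    split_ifs
    · simp
    · rw [sq_abs, show x * (OmRD l / m) * (1 - lamRD l ^ 2) = x * (OmRD l * (1 - lamRD l ^ 2) / m)
        by ring]
      field_simp
  rw [hprod, hsumSD, hsumRD]
  ring

end Matrices

/-! ### The distribution function of the summed SNR -/

section CombinedSNR

variable {S : Type*} [MeasurableSpace S] {μ : Measure S} [IsProbabilityMeasure μ]
variable {M r : ℕ} {m : ℝ} {OmSD OmRD lamSD lamRD : Fin M → ℝ} {hSD hRD : Fin M → S → ℂ}

/-- The Laplace transform of the sum of squared amplitudes scaled by the common factor `γT`. -/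
theorem lintegral_exp_neg_sum_sq (hm : 0 < m)
    (hOmSD : ∀ l, 0 < OmSD l) (hOmRD : ∀ l, 0 < OmRD l)
    (hlamSD : ∀ l, |lamSD l| < 1) (hlamRD : ∀ l, |lamRD l| < 1)
    (hSD_meas : ∀ l, Measurable (hSD l)) (hRD_meas : ∀ l, Measurable (hRD l))
    (hSD_law : HasNakagamiAmplitudes μ m OmSD lamSD hSD)
    (hRD_law : HasNakagamiAmplitudes μ m OmRD lamRD hRD)
    (h_indep : ProbabilityTheory.IndepFun (fun s l => hSD l s) (fun s l => hRD l s) μ)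
    {x : ℝ} (hx : 0 ≤ x) :
    ∫⁻ s, ENNReal.ofReal (Real.exp
        (-(x * ∑ l : Fin M, if (l : ℕ) < r then ‖hSD l s‖ ^ 2 else ‖hRD l s‖ ^ 2))) ∂μ =
      ENNReal.ofReal ((1 + x • (gainMatrix r m OmSD OmRD *
        corrMatrix r (powerCorr μ hSD) (powerCorr μ hRD))).det ^ (-m)) := by
  -- The joint Laplace transforms are taken at arguments that vanish on the SNRs left out of the sum.
  set a : Fin M → ℝ := fun l => if (l : ℕ) < r then x else 0 with ha
  set b : Fin M → ℝ := fun l => if (l : ℕ) < r then 0 else x with hb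
  have ha0 : ∀ l, 0 ≤ a l := fun l => by simp only [ha]; split_ifs <;> simp [hx]
  have hb0 : ∀ l, 0 ≤ b l := fun l => by simp only [hb]; split_ifs <;> simp [hx]
  have hfac : ∀ s, ENNReal.ofReal (Real.exp
      (-(x * ∑ l : Fin M, if (l : ℕ) < r then ‖hSD l s‖ ^ 2 else ‖hRD l s‖ ^ 2))) =
      ((fun s => ENNReal.ofReal (Real.exp (-∑ l, a l * ‖hSD l s‖ ^ 2))) *
        fun s => ENNReal.ofReal (Real.exp (-∑ l, b l * ‖hRD l s‖ ^ 2))) s := fun s => by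
    rw [Pi.mul_apply, ← ENNReal.ofReal_mul (Real.exp_pos _).le, ← Real.exp_add, ← neg_add,
      ← Finset.sum_add_distrib, Finset.mul_sum]
    congr 3
    refine Finset.sum_congr rfl fun l _ => ?_
    simp only [ha, hb]
    split_ifs <;> ring
  have hφ : ∀ c : Fin M → ℝ, Measurable fun z : Fin M → ℂ =>
      ENNReal.ofReal (Real.exp (-∑ l, c l * ‖z l‖ ^ 2)) := fun c => by fun_prop
  have hind : ProbabilityTheory.IndepFun
      (fun s => ENNReal.ofReal (Real.exp (-∑ l, a l * ‖hSD l s‖ ^ 2)))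
      (fun s => ENNReal.ofReal (Real.exp (-∑ l, b l * ‖hRD l s‖ ^ 2))) μ :=
    h_indep.comp (hφ a) (hφ b)
  simp_rw [hfac]
  rw [ProbabilityTheory.lintegral_mul_eq_lintegral_mul_lintegral_of_indepFun (by fun_prop)
      (by fun_prop) hind,
    hSD_law.lintegral_exp hSD_meas hm hOmSD hlamSD ha0,
    hRD_law.lintegral_exp hRD_meas hm hOmRD hlamRD hb0]
  have hpos : ∀ {c Om lam : Fin M → ℝ}, (∀ l, 0 ≤ c l) → (∀ l, 0 < Om l) → (∀ l, |lam l| < 1) →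
      0 ≤ (∏ l, (1 + c l * (Om l * (1 - lam l ^ 2) / m))) *
        (1 + ∑ l, lam l ^ 2 / (1 - lam l ^ 2) * (c l * (Om l * (1 - lam l ^ 2) / m) /
          (1 + c l * (Om l * (1 - lam l ^ 2) / m)))) := fun {c Om lam} hc hOm hlam => by
    have h1 : ∀ l, 0 ≤ c l * (Om l * (1 - lam l ^ 2) / m) := fun l => by
      have := one_sub_sq_pos (hlam l)
      have := hc l
      have := hOm l
      positivity
    refine mul_nonneg (Finset.prod_nonneg fun l _ => ?_)
      (add_nonneg zero_le_one (Finset.sum_nonneg fun l _ => ?_))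
    · linarith [h1 l]
    · have := one_sub_sq_pos (hlam l)
      have := h1 l
      positivity
  have h1 := hpos ha0 hOmSD hlamSD
  have h2 := hpos hb0 hOmRD hlamRD
  rw [det_one_add_smul_gainMatrix_mul_corrMatrix (ρSD := powerCorr μ hSD) (ρRD := powerCorr μ hRD)
    (fun l k hlk => hSD_law.powerCorr_eq hSD_meas hm hOmSD hlamSD hlk)
    (fun l k hlk => hRD_law.powerCorr_eq hRD_meas hm hOmRD hlamRD hlk)
    hlamSD hlamRD hm hOmSD hOmRD hx ha hb, Real.mul_rpow h1 h2,
    ENNReal.ofReal_mul (Real.rpow_nonneg h1 _)]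

end CombinedSNR

theorem theorem3
    {S : Type*} [MeasurableSpace S] (μ : MeasureTheory.Measure S)
    [MeasureTheory.IsProbabilityMeasure μ]
    (M r : ℕ) (hr : 1 ≤ r) (hrM : r ≤ M)
    (m : ℝ) (hm : 0 < m)
    (OmSD OmRD lamSD lamRD : Fin M → ℝ)
    (hOmSD : ∀ l, 0 < OmSD l) (hOmRD : ∀ l, 0 < OmRD l)
    (hlamSD : ∀ l, |lamSD l| < 1) (hlamRD : ∀ l, |lamRD l| < 1)
    (hSD hRD : Fin M → S → ℂ)
    (hSD_meas : ∀ l, Measurable (hSD l)) (hRD_meas : ∀ l, Measurable (hRD l))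
    (hSD_law : HasNakagamiAmplitudes μ m OmSD lamSD hSD)
    (hRD_law : HasNakagamiAmplitudes μ m OmRD lamRD hRD)
    (h_indep : ProbabilityTheory.IndepFun (fun s l => hSD l s) (fun s l => hRD l s) μ)
    (PS PR NSD NRD : Fin M → ℝ) (γT : ℝ)
    (hPS : ∀ l, 0 < PS l) (hPR : ∀ l, 0 < PR l)
    (hNSD : ∀ l, 0 < NSD l) (hNRD : ∀ l, 0 < NRD l)
    (hγSD : ∀ l, PS l / NSD l = γT) (hγRD : ∀ l, PR l / NRD l = γT)
    (F E B : Matrix (Fin M) (Fin M) ℝ)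
    (hF : F = gainMatrix r m OmSD OmRD)
    (hE : E = corrMatrix r (powerCorr μ hSD) (powerCorr μ hRD))
    (hB : B = F * E) :
    E.PosDef ∧
    (∃ δ : Fin M → ℝ, IsEigenvalueList B δ) ∧
    ∀ δ : Fin M → ℝ, IsEigenvalueList B δ →
      (∀ k, 0 < δ k) ∧
      ∀ y : ℝ, 0 ≤ y →
        Summable (lauricellaPhi2Term (fun _ : Fin M => m) (M * m + 1)
          (fun k => -(y / (γT * δ k)))) ∧
        ProbabilityTheory.cdf
            (μ.map (sumSNR r (fun l => snr (PS l) (NSD l) (hSD l))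
              (fun l => snr (PR l) (NRD l) (hRD l)))) y =
          y ^ (M * m) / (γT ^ (M * m) * B.det ^ m * Real.Gamma (M * m + 1)) *
            lauricellaPhi2 (fun _ : Fin M => m) (M * m + 1)
              (fun k => -(y / (γT * δ k))) := by
  have hρSD := fun l k hlk => hSD_law.powerCorr_eq hSD_meas hm hOmSD hlamSD (l := l) (k := k) hlk
  have hρRD := fun l k hlk => hRD_law.powerCorr_eq hRD_meas hm hOmRD hlamRD (l := l) (k := k) hlk
  have hEpos : E.PosDef := hE ▸ posDef_corrMatrix hρSD hρRD hlamSD hlamRD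
  have hM : 0 < M := lt_of_lt_of_le hr hrM
  have hγ : 0 < γT := hγSD ⟨0, hM⟩ ▸ div_pos (hPS _) (hNSD _)
  obtain ⟨δ', hδ'pos, hδ'⟩ : ∃ δ : Fin M → ℝ, (∀ k, 0 < δ k) ∧ IsEigenvalueList B δ := by
    rw [hB, hF]
    refine exists_isEigenvalueList_diagonal_mul (fun l => ?_) hEpos
    have := hOmSD l
    have := hOmRD l
    split_ifs <;> positivity
  refine ⟨hEpos, ⟨δ', hδ'⟩, fun δ hδ => ?_⟩
  have hδpos := hδ.pos hδ' hδ'pos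
  refine ⟨hδpos, fun y hy => ?_⟩
  set A : ℝ := M * m with hA
  have hA0 : 0 < A := by positivity
  have hsum : ∑ _k : Fin M, m ≤ A + 1 := by simp [hA]
  refine ⟨summable_lauricellaPhi2Term (fun _ => hm.le) (by positivity) hsum _, ?_⟩
  set β : Fin M → ℝ := fun k => 1 / (γT * δ k) with hβ
  have hβ0 : ∀ k, 0 < β k := fun k => by have := hδpos k; positivity
  have hdet : B.det = ∏ k, δ k := hδ.det_eq
  have hdet0 : 0 < B.det := hdet ▸ Finset.prod_pos fun k _ => hδpos k
  have hcont := continuous_lauricellaPhi2 (fun _ : Fin M => hm.le) (by positivity) hsum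
  set Y : S → ℝ := sumSNR r (fun l => snr (PS l) (NSD l) (hSD l))
    (fun l => snr (PR l) (NRD l) (hRD l)) with hY
  have hYeq : ∀ s, Y s =
      γT * ∑ l : Fin M, if (l : ℕ) < r then ‖hSD l s‖ ^ 2 else ‖hRD l s‖ ^ 2 := fun s => by
    simp only [hY, sumSNR, snr, Finset.mul_sum]
    refine Finset.sum_congr rfl fun l _ => ?_
    split_ifs
    · rw [← hγSD l]; ring
    · rw [← hγRD l]; ring
  have hYmeas : Measurable Y := by
    rw [funext hYeq]
    refine (Finset.measurable_fun_sum _ fun l _ => ?_).const_mul _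
    have := hSD_meas l
    have := hRD_meas l
    split_ifs <;> fun_prop
  have hYnn : ∀ s, 0 ≤ Y s := fun s => by
    rw [hYeq]
    refine mul_nonneg hγ.le (Finset.sum_nonneg fun l _ => ?_)
    split_ifs <;> positivity
  have : IsProbabilityMeasure (μ.map Y) := Measure.isProbabilityMeasure_map hYmeas.aemeasurable
  -- The binomial series converge for `s` larger than every `β k`.
  have hβle : ∀ k, β k < 1 + ∑ k, β k := fun k => by
    have := Finset.single_le_sum (fun i _ => (hβ0 i).le) (Finset.mem_univ k)
    linarith
  have hs₀ : 0 < 1 + ∑ k, β k :=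
    add_pos_of_pos_of_nonneg one_pos (Finset.sum_nonneg fun k _ => (hβ0 k).le)
  have hG := cdf_eq_of_laplace_eq (μ.map Y)
    ((ae_map_iff hYmeas.aemeasurable measurableSet_Ici).2 (Filter.Eventually.of_forall hYnn))
    (G := fun y => 1 / (γT ^ A * B.det ^ m) * (y ^ A / Real.Gamma (A + 1) *
      lauricellaPhi2 (fun _ : Fin M => m) (A + 1) (fun k => -(y * β k))))
    (L := fun s => ∏ k, (1 + s * γT * δ k) ^ (-m)) ?_ hs₀ ?_ ?_ ?_ hy
  · rw [hG]
    have h1 : (fun k => -(y * β k)) = fun k => -(y / (γT * δ k)) := by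
      ext k
      simp only [hβ]
      ring
    rw [h1]
    simp only [div_eq_mul_inv, mul_inv]
    ring
  · refine Continuous.continuousOn (continuous_const.mul (Continuous.mul ?_ ?_))
    · exact (Real.continuous_rpow_const hA0.le).div_const _
    · exact hcont.comp (by fun_prop)
  · intro s hs
    have : 0 < s := hs₀.trans_le hs
    refine Finset.prod_pos fun k _ => ?_
    have := hδpos k
    positivity
  · intro s hs
    have hs' : 0 < s := hs₀.trans_le hs
    rw [lintegral_map (by fun_prop) hYmeas]
    have h1 := lintegral_exp_neg_sum_sq (r := r) hm hOmSD hOmRD hlamSD hlamRD hSD_meas hRD_meas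
      hSD_law hRD_law h_indep (x := s * γT) (by positivity)
    simp_rw [hYeq, ← mul_assoc]
    rw [h1, ← hE, ← hF, ← hB, hδ.det_one_add_smul (by positivity),
      Real.finsetProd_rpow _ _ fun k _ => by have := hδpos k; positivity]
  · intro s hs
    have hs' : 0 < s := hs₀.trans_le hs
    have h1 := integral_exp_mul_lauricellaPhi2 (b := fun _ : Fin M => m) hA0 (fun _ => hm.le)
      (fun k => (hβ0 k).le) hs' fun k => (hβle k).trans_le hs
    have h2 : ∀ k, (1 + β k / s) ^ (-m) =
        (s * γT) ^ m * δ k ^ m * (1 + s * γT * δ k) ^ (-m) := fun k => by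
      have := hδpos k
      rw [show 1 + β k / s = (1 + s * γT * δ k) * (s * γT * δ k)⁻¹ by
          simp only [hβ]; field_simp; ring,
        Real.mul_rpow (by positivity) (by positivity), Real.inv_rpow (by positivity),
        Real.rpow_neg (x := s * γT * δ k) (by positivity), inv_inv,
        Real.mul_rpow (x := s * γT) (by positivity) this.le]
      ring
    have h3 : ((s * γT) ^ m) ^ M = s ^ A * γT ^ A := by
      rw [← Real.rpow_natCast, ← Real.rpow_mul (by positivity), mul_comm m, ← hA,
        Real.mul_rpow hs'.le hγ.le]
    simp_rw [mul_left_comm (Real.exp _) (1 / (γT ^ A * B.det ^ m))]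
    rw [integral_const_mul, h1]
    simp_rw [h2]
    rw [Finset.prod_mul_distrib, Finset.prod_mul_distrib, Finset.prod_const, Finset.card_univ,
      Fintype.card_fin, h3, Real.finsetProd_rpow _ _ fun k _ => (hδpos k).le, ← hdet,
      one_div s, Real.inv_rpow hs'.le]
    have h4 : 0 < B.det ^ m := Real.rpow_pos_of_pos hdet0 _
    have h5 : 0 < s ^ A := Real.rpow_pos_of_pos hs' _
    have h6 : 0 < γT ^ A := Real.rpow_pos_of_pos hγ _
    field_simp
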